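/- **Theorem (Existence of slow solutions).** Let $H$ be a real Hilbert space and let $A$ be a nonnegative self-adjoint linear operator on $H$ with dense domain. Let $D(A^{1/2})$ be equipped with the norm $|u|_{D(A^{1/2})}=(|u|^2+|A^{1/2}u|^2)^{1/2}$, where $|\cdot|$ and $\langle\cdot,\cdot\rangle$ are the norm and scalar product of $H$. Let $F:D(A^{1/2})\to[0,+\infty)$ satisfy $F(0)=0$, and assume that $F$ has a gradient $\nabla F:D(A^{1/2})\to H$ in the sense that $$\lim_{|v|_{D(A^{1/2})}\to 0}\frac{F(u+v)-F(u)-\langle\nabla F(u),v\rangle}{|v|}=0\qquad\forall u\in D(A^{1/2}),$$ and that $\nabla F$ is locally Lipschitz continuous, namely $$|\nabla F(u)-\nabla F(v)|\le L\big(|u|_{D(A^{1/2})},|v|_{D(A^{1/2})}\big)\,|u-v|_{D(A^{1/2})}\qquad\forall u,v\in D(A^{1/2})$$ for some function $L:\mathbb R^2\to\mathbb R$ that is bounded on bounded sets. Assume in addition that $\ker A\ne\{0\}$; that there is $\nu>0$ such that $$|A^{1/2}u|^2\ge\nu|u|^2\qquad\forall u\in D(A^{1/2})\cap(\ker A)^\perp;$$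 and that, for some real number $p>0$, there are $\rho>0$, $R>0$, $\alpha>0$ such that $$|\nabla F(u)|\le R\left(|u|^{p+1}+|A^{1/2}u|^{1+\alpha}\right)\qquad\text{for all }u\in D(A^{1/2})\text{ with }|u|_{D(A^{1/2})}\le\rho .$$ Then there exist a nonempty open set $\mathcal S\subseteq D(A^{1/2})\times H$ and a constant $M_3>0$ such that, for every $(u_0,u_1)\in\mathcal S$, the problem $$u''(t)+u'(t)+Au(t)+\nabla F(u(t))=0\quad(t\ge0),\qquad u(0)=u_0,\quad u'(0)=u_1$$ has a unique global weak solution $u\in C^0([0,+\infty);D(A^{1/2}))\cap C^1([0,+\infty);H)$, and this solution satisfies $$|u(t)|\ge\frac{M_3}{(1+t)^{1/p}}\qquad\forall t\ge0 .$$ Here a weak solution is a function $u$ in the above class that attains the initial data and satisfies, for every $\varphi\in D(A^{1/2})$ and every $t\ge0$, $$\frac{d}{dt}\langle u'(t),\varphi\rangle+\langle u'(t),\varphi\rangle+\langle A^{1/2}u(t),A^{1/2}\varphi\rangle+\langle\nabla F(u(t)),\varphi\rangle=0 .$$ -/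

import Mathlib

open Set Filter Topology
open scoped RealInnerProductSpace

noncomputable section

namespace SlowSolutions

universe u

variable {H : Type u} [NormedAddCommGroup H] [InnerProductSpace ℝ H] [CompleteSpace H]

/-- The kernel of a partially defined operator, as a subspace of `H`. -/
def opKer (A : H →ₗ.[ℝ] H) : Submodule ℝ H :=
  (LinearMap.ker A.toFun).map A.domain.subtype

/-- A partially defined operator is nonnegative if `⟨Au, u⟩ ≥ 0` for every `u ∈ D(A)`. -/
def IsNonneg (A : H →ₗ.[ℝ] H) : Prop :=
  ∀ x : A.domain, 0 ≤ ⟪A x, (x : H)⟫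

/-- `B` is a nonnegative self-adjoint operator with `B² = A`. The last field says that
`x ∈ D(A)` and `A x = y` if and only if `x ∈ D(B)`, `B x ∈ D(B)` and `B (B x) = y`. -/
structure IsNonnegSqrt (A B : H →ₗ.[ℝ] H) : Prop where
  selfAdjoint : IsSelfAdjoint B
  nonneg : IsNonneg B
  sq_eq : ∀ x y : H, (x, y) ∈ A.graph ↔ ∃ z : H, (x, z) ∈ B.graph ∧ (z, y) ∈ B.graph

open Classical in
/-- The square root `A^{1/2}`: the (unique) nonnegative self-adjoint operator whose square is `A`.
Such an operator exists for every nonnegative self-adjoint `A`; the value is irrelevant for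
other `A`. -/
def opSqrt (A : H →ₗ.[ℝ] H) : H →ₗ.[ℝ] H :=
  if h : ∃ B : H →ₗ.[ℝ] H, IsNonnegSqrt A B then h.choose else ⊥

/-- The vector space `D(A^{1/2})`. It is a type synonym, so that it can carry the graph norm
instead of the norm of `H`. -/
def SqrtDomain (A : H →ₗ.[ℝ] H) : Type u := (opSqrt A).domain

namespace SqrtDomain

variable {A : H →ₗ.[ℝ] H}

instance instAddCommGroup : AddCommGroup (SqrtDomain A) :=
  inferInstanceAs (AddCommGroup (opSqrt A).domain)

instance instModule : Module ℝ (SqrtDomain A) :=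
  inferInstanceAs (Module ℝ (opSqrt A).domain)

/-- The inclusion `D(A^{1/2}) → H`. -/
def toH : SqrtDomain A →ₗ[ℝ] H := (opSqrt A).domain.subtype

/-- The operator `A^{1/2} : D(A^{1/2}) → H`. -/
def sqrtOp : SqrtDomain A →ₗ[ℝ] H := (opSqrt A).toFun

/-- The graph map `u ↦ (u, A^{1/2} u)` into the Hilbert sum `H ⊕ H`. -/
def graphMap : SqrtDomain A →ₗ[ℝ] WithLp 2 (H × H) :=
  (WithLp.linearEquiv 2 ℝ (H × H)).symm.toLinearMap ∘ₗ (toH.prod sqrtOp)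

theorem graphMap_injective : Function.Injective (graphMap (A := A)) := by
  intro x y h
  have h1 : (graphMap x).fst = (graphMap y).fst := by rw [h]
  exact Subtype.ext h1

/-- `D(A^{1/2})` carries the graph norm, `|u|² + |A^{1/2} u|²` under the square root. -/
instance instNormedAddCommGroup : NormedAddCommGroup (SqrtDomain A) :=
  NormedAddCommGroup.induced (SqrtDomain A) (WithLp 2 (H × H)) graphMap graphMap_injective

theorem norm_eq (x : SqrtDomain A) :
    ‖x‖ = Real.sqrt (‖toH x‖ ^ 2 + ‖sqrtOp x‖ ^ 2) := by
  change ‖graphMap x‖ = _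
  rw [WithLp.prod_norm_eq_of_L2]
  rfl

instance instInnerProductSpace : InnerProductSpace ℝ (SqrtDomain A) where
  norm_smul_le a x := by
    change ‖graphMap (a • x)‖ ≤ ‖a‖ * ‖graphMap x‖
    rw [map_smul]
    exact norm_smul_le _ _
  inner x y := ⟪toH x, toH y⟫ + ⟪sqrtOp x, sqrtOp y⟫
  norm_sq_eq_re_inner x := by
    rw [norm_eq, Real.sq_sqrt (by positivity)]
    simp
  conj_inner_symm x y := by
    simp [real_inner_comm]
  add_left x y z := by
    simp only [map_add, inner_add_left]
    ring
  smul_left x y r := by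
    simp only [map_smul, real_inner_smul_left]
    simp
    ring

end SqrtDomain

open SqrtDomain

variable {A : H →ₗ.[ℝ] H}

/-- `G` is the gradient of `F : D(A^{1/2}) → ℝ`: for every `u`, the quotient
`(F(u+v) - F(u) - ⟨G u, v⟩) / |v|` tends to `0` as `v → 0`, `v ≠ 0`, in the norm of `D(A^{1/2})`.
The inner product and the norm in the quotient are those of `H`. -/
def IsGradient (F : SqrtDomain A → ℝ) (G : SqrtDomain A → H) : Prop :=
  ∀ w : SqrtDomain A,
    Tendsto (fun v : SqrtDomain A => (F (w + v) - F w - ⟪G w, toH v⟫) / ‖toH v‖) (𝓝[≠] 0) (𝓝 0)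

/-- Local Lipschitz continuity of `G : D(A^{1/2}) → H`:
`|G u - G v| ≤ L(|u|, |v|) |u - v|`, with norms of `D(A^{1/2})` on the right-hand side and
a function `L : ℝ² → ℝ` that is bounded on bounded sets. -/
def IsLocLipschitz (G : SqrtDomain A → H) : Prop :=
  ∃ L : ℝ × ℝ → ℝ,
    (∀ s : Set (ℝ × ℝ), Bornology.IsBounded s → Bornology.IsBounded (L '' s)) ∧
    ∀ v w : SqrtDomain A, ‖G v - G w‖ ≤ L (‖v‖, ‖w‖) * ‖v - w‖

/-- The time derivative in `H` of a curve in `D(A^{1/2})` defined for `t ≥ 0`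
(one-sided at `t = 0`). -/
def timeDeriv (w : ℝ → SqrtDomain A) (t : ℝ) : H :=
  derivWithin (fun s => toH (w s)) (Ici 0) t

/-- Global weak solutions of `w'' + w' + A w + G(w) = 0`, `w(0) = u₀`, `w'(0) = u₁`:
curves in `C⁰([0,∞); D(A^{1/2})) ∩ C¹([0,∞); H)` that satisfy the equation tested against
every `φ ∈ D(A^{1/2})`, that is
`d/dt ⟨w', φ⟩ + ⟨w', φ⟩ + ⟨A^{1/2} w, A^{1/2} φ⟩ + ⟨G(w), φ⟩ = 0` for all `t ≥ 0`.
Only the values of `w` at times `t ≥ 0` matter. -/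
structure IsWeakSolution (G : SqrtDomain A → H) (u₀ : SqrtDomain A) (u₁ : H)
    (w : ℝ → SqrtDomain A) : Prop where
  continuousOn : ContinuousOn w (Ici 0)
  contDiffOn : ContDiffOn ℝ 1 (fun t => toH (w t)) (Ici 0)
  init : w 0 = u₀
  init_deriv : timeDeriv w 0 = u₁
  equation : ∀ φ : SqrtDomain A, ∀ t : ℝ, 0 ≤ t →
    HasDerivWithinAt (fun s => ⟪timeDeriv w s, toH φ⟫)
      (-(⟪timeDeriv w t, toH φ⟫ + ⟪sqrtOp (w t), sqrtOp φ⟫ + ⟪G (w t), toH φ⟫)) (Ici 0) t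

end SlowSolutions

end

/-!
Slow solutions of a dissipative wave equation.

Why slow solutions exist. Write `B = A^{1/2}`, `a = |u'|`, `d = |B u|`, `r = |u|`. If the ratio
`(a² + d²) / r ^ (2p+2)` stays bounded along a solution, then `|u'| ≤ K |u| ^ (p+1)`, so
`|u| ^ (-p)` grows at most linearly in time and `|u|` decays no faster than `(1 + t) ^ (-1/p)`. The
ratio does stay bounded. The energy `½ (a² + d²)`, perturbed by a small multiple of
`⟪u', B (1 + B)⁻¹ u⟫`, dissipates a multiple of `a² + d²`, because `B` is coercive off its kernel,
up to an error `2 |∇F(u)|² ≲ r ^ (2p+2) + d ^ (2+2α)` (`exists_hasDerivWithinAt_perturbedEnergy`).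
While `r` is small, `r ^ (2p+2)` varies slowly compared with this exponential decay, so the perturbed
energy cannot cross `M r ^ (2p+2)` from below (`barrier_inequality`). While `r` is not small, the
perturbed energy is below `M r ^ (2p+2)` simply because the total energy
`½ (a² + d²) + F(u)` is nonincreasing and was small initially; this is where `F ≥ 0` enters
(`IsWaveSolution.perturbedEnergy_le`). Initial data near `(s e, 0)` with `e ∈ ker A` and small
`s > 0` satisfy all requirements, and these requirements are open conditions.

The analytic foundation. The square root of `A` is built from the resolvent `Q = (1 + A)⁻¹` as
`√(1 - Q) (√Q)⁻¹`, where square roots of bounded operators come from the power series of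
`1 - √(1 - X)`, whose coefficients are Catalan numbers (`exists_isNonnegSqrt`). No uniqueness of the
square root is needed, since afterwards only self-adjointness, nonnegativity and `B² = A` are used.

With `Q = (1 + B)⁻¹`, the wave equation is a first-order system for `x = (1 + B) u` and `y = u'`,
namely `x' = (1 + B) y`, `y' = -(1 + B) x + h` with a force `h` that is bounded in `x` and `y` up to
the nonlinearity. The linear part generates a group `U` of isometries of `H ⊕ H`
(`exists_isGroupGeneratedByInv`), and `w(t) = U(-t) (x, y)` solves an ordinary differential equation
whose right-hand side is Lipschitz on bounded sets (`IsWaveCurve.hasDerivWithinAt_unwind`). From this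
come uniqueness, global existence (with the a priori bound from the energy), and the energy
identities, for which `u` is not regular enough to differentiate directly. The definition of the
gradient, with the error divided by the norm of `H`, is what makes `F(u(t))` differentiable in time
(`IsPotential.hasDerivWithinAt`).
-/

set_option linter.unusedSectionVars false

noncomputable section

namespace SlowSolutions

/-! ### Square roots in Banach algebras -/

/-- The coefficients of `1 - √(1 - X)` telescope in terms of central binomial coefficients. -/
theorem catalan_div_four_pow_eq (n : ℕ) :
    2 * (catalan n : ℝ) / 4 ^ (n + 1) =
      (Nat.centralBinom n : ℝ) / 4 ^ n - (Nat.centralBinom (n + 1) : ℝ) / 4 ^ (n + 1) := by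
  have h1 : ((n : ℝ) + 1) * catalan n = Nat.centralBinom n := by
    exact_mod_cast succ_mul_catalan_eq_centralBinom n
  have h2 : ((n : ℝ) + 1) * Nat.centralBinom (n + 1) = 2 * (2 * n + 1) * Nat.centralBinom n := by
    exact_mod_cast Nat.succ_mul_centralBinom_succ n
  have h3 : (Nat.centralBinom (n + 1) : ℝ) = 2 * (2 * n + 1) * catalan n := by
    have h0 : (n : ℝ) + 1 ≠ 0 := by positivity
    apply mul_left_cancel₀ h0
    rw [h2, ← h1]; ring
  rw [h3, ← h1, pow_succ]
  field_simp
  ring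

theorem sum_catalan_div_four_pow_le (N : ℕ) :
    ∑ n ∈ Finset.range N, 2 * (catalan n : ℝ) / 4 ^ (n + 1) ≤ 1 := by
  simp_rw [catalan_div_four_pow_eq]
  rw [Finset.sum_range_sub']
  simp only [Nat.centralBinom_zero, pow_zero, Nat.cast_one, div_one]
  have : 0 ≤ (Nat.centralBinom N : ℝ) / 4 ^ N := by positivity
  linarith

section BanachAlgebra

variable {E : Type*} [NormedRing E] [NormedAlgebra ℝ E]

/-- The power series `1 - √(1 - X) = ∑ 2 Cₙ (X/4)ⁿ⁺¹`, with `Cₙ` the Catalan numbers; it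
converges on the closed unit ball. -/
def oneSubSqrt (X : E) : E := ∑' n : ℕ, (2 * (catalan n : ℝ) / 4 ^ (n + 1)) • X ^ (n + 1)

theorem norm_oneSubSqrt_term_le {X : E} (hX : ‖X‖ ≤ 1) (n : ℕ) :
    ‖(2 * (catalan n : ℝ) / 4 ^ (n + 1)) • X ^ (n + 1)‖ ≤ 2 * (catalan n : ℝ) / 4 ^ (n + 1) := by
  have h0 : 0 ≤ 2 * (catalan n : ℝ) / 4 ^ (n + 1) := by positivity
  rw [norm_smul, Real.norm_of_nonneg h0]
  refine mul_le_of_le_one_right h0 ?_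
  exact (norm_pow_le' X n.succ_pos).trans (pow_le_one₀ (norm_nonneg _) hX)

theorem summable_catalan_div_four_pow :
    Summable fun n : ℕ => 2 * (catalan n : ℝ) / 4 ^ (n + 1) :=
  summable_of_sum_range_le (fun _ => by positivity) sum_catalan_div_four_pow_le

theorem summable_norm_oneSubSqrt {X : E} (hX : ‖X‖ ≤ 1) :
    Summable fun n : ℕ => ‖(2 * (catalan n : ℝ) / 4 ^ (n + 1)) • X ^ (n + 1)‖ :=
  summable_catalan_div_four_pow.of_nonneg_of_le (fun _ => norm_nonneg _)
    (norm_oneSubSqrt_term_le hX)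

theorem norm_oneSubSqrt_le {X : E} (hX : ‖X‖ ≤ 1) : ‖oneSubSqrt X‖ ≤ 1 := by
  refine (tsum_of_norm_bounded summable_catalan_div_four_pow.hasSum
    (norm_oneSubSqrt_term_le hX)).trans ?_
  exact summable_catalan_div_four_pow.tsum_le_of_sum_range_le sum_catalan_div_four_pow_le

theorem commute_oneSubSqrt {C X : E} (h : Commute C X) : Commute C (oneSubSqrt X) :=
  Commute.tsum_right C fun n => (h.pow_right (n + 1)).smul_right _

/-- The recursion of the Catalan numbers says that `Y = oneSubSqrt X` solves `Y² = 2Y - X`. -/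
theorem one_sub_oneSubSqrt_sq [CompleteSpace E] {X : E} (hX : ‖X‖ ≤ 1) :
    (1 - oneSubSqrt X) * (1 - oneSubSqrt X) = 1 - X := by
  have hs := summable_norm_oneSubSqrt hX
  have hs' : Summable fun n : ℕ => (2 * (catalan n : ℝ) / 4 ^ (n + 1)) • X ^ (n + 1) := hs.of_norm
  have hmul : oneSubSqrt X * oneSubSqrt X = 2 • oneSubSqrt X - X := by
    have h1 : oneSubSqrt X * oneSubSqrt X =
        ∑' n : ℕ, (2 * (2 * (catalan (n + 1) : ℝ) / 4 ^ (n + 2))) • X ^ (n + 2) := by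
      rw [oneSubSqrt, tsum_mul_tsum_eq_tsum_sum_antidiagonal_of_summable_norm hs hs]
      refine tsum_congr fun n => ?_
      have h2 : ∀ ij ∈ Finset.HasAntidiagonal.antidiagonal n,
          ((2 * (catalan ij.1 : ℝ) / 4 ^ (ij.1 + 1)) • X ^ (ij.1 + 1)) *
            ((2 * (catalan ij.2 : ℝ) / 4 ^ (ij.2 + 1)) • X ^ (ij.2 + 1)) =
          ((4 / 4 ^ (n + 2)) * ((catalan ij.1 : ℝ) * catalan ij.2)) • X ^ (n + 2) := by
        intro ij hij
        have h3 : n = ij.1 + ij.2 := (Finset.HasAntidiagonal.mem_antidiagonal.1 hij).symm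
        rw [smul_mul_smul_comm, ← pow_add, h3,
          show ij.1 + 1 + (ij.2 + 1) = ij.1 + ij.2 + 2 by ring]
        congr 1
        rw [show ij.1 + ij.2 + 2 = (ij.1 + 1) + (ij.2 + 1) by ring, pow_add]
        field_simp
        ring
      rw [Finset.sum_congr rfl h2, ← Finset.sum_smul, ← Finset.mul_sum, catalan_succ']
      congr 1
      push_cast
      ring
    have h4 : oneSubSqrt X = (1 / 2 : ℝ) • X +
        ∑' n : ℕ, (2 * (catalan (n + 1) : ℝ) / 4 ^ (n + 2)) • X ^ (n + 2) := by
      rw [oneSubSqrt, hs'.tsum_eq_zero_add]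
      congr 1
      norm_num
    have h5 : ∑' n : ℕ, (2 * (2 * (catalan (n + 1) : ℝ) / 4 ^ (n + 2))) • X ^ (n + 2) =
        (2 : ℝ) • ∑' n : ℕ, (2 * (catalan (n + 1) : ℝ) / 4 ^ (n + 2)) • X ^ (n + 2) := by
      rw [← tsum_const_smul'']
      simp_rw [mul_smul]
    rw [h1, h5, h4]
    module
  have h6 : (1 - oneSubSqrt X) * (1 - oneSubSqrt X) =
      1 - 2 • oneSubSqrt X + oneSubSqrt X * oneSubSqrt X := by noncomm_ring
  rw [h6, hmul]
  abel

end BanachAlgebra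

section Hilbert

variable {H : Type*} [NormedAddCommGroup H] [InnerProductSpace ℝ H] [CompleteSpace H]

theorem isSelfAdjoint_oneSubSqrt {X : H →L[ℝ] H} (hX : IsSelfAdjoint X) :
    IsSelfAdjoint (oneSubSqrt X) := by
  rw [IsSelfAdjoint, oneSubSqrt, tsum_star]
  refine tsum_congr fun n => ?_
  rw [star_smul, star_pow, hX.star_eq, star_trivial]

/-- A self-adjoint operator `T` with `‖1 - T‖ ≤ 1` has a nonnegative square root that commutes with
every operator commuting with `T`. -/
theorem exists_sqrt_of_norm_one_sub_le {T : H →L[ℝ] H} (hT : IsSelfAdjoint T)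
    (hT1 : ‖1 - T‖ ≤ 1) :
    ∃ S : H →L[ℝ] H, IsSelfAdjoint S ∧ S * S = T ∧ ‖1 - S‖ ≤ 1 ∧
      ∀ C : H →L[ℝ] H, Commute C T → Commute C S := by
  refine ⟨1 - oneSubSqrt (1 - T), ?_, ?_, ?_, ?_⟩
  · exact (IsSelfAdjoint.one _).sub (isSelfAdjoint_oneSubSqrt ((IsSelfAdjoint.one _).sub hT))
  · rw [one_sub_oneSubSqrt_sq hT1]; simp
  · simpa using norm_oneSubSqrt_le hT1
  · intro C hC
    exact (Commute.one_right C).sub_right (commute_oneSubSqrt ((Commute.one_right C).sub_right hC))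

theorem inner_apply_comm_of_isSelfAdjoint {T : H →L[ℝ] H} (hT : IsSelfAdjoint T) (x y : H) :
    ⟪T x, y⟫ = ⟪x, T y⟫ :=
  (ContinuousLinearMap.isSelfAdjoint_iff_isSymmetric.1 hT) x y

theorem isSelfAdjoint_of_inner_apply_comm {T : H →L[ℝ] H} (hT : ∀ x y, ⟪T x, y⟫ = ⟪x, T y⟫) :
    IsSelfAdjoint T :=
  ContinuousLinearMap.isSelfAdjoint_iff_isSymmetric.2 hT

theorem inner_apply_self_nonneg_of_norm_one_sub_le {T : H →L[ℝ] H} (hT1 : ‖1 - T‖ ≤ 1) (x : H) :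
    0 ≤ ⟪T x, x⟫ := by
  have h1 : ⟪(1 - T) x, x⟫ ≤ ‖x‖ * ‖x‖ := by
    refine (real_inner_le_norm _ _).trans ?_
    gcongr
    simpa using (1 - T).le_of_opNorm_le hT1 x
  have h2 : ⟪(1 - T) x, x⟫ = ‖x‖ * ‖x‖ - ⟪T x, x⟫ := by
    rw [← real_inner_self_eq_norm_mul_norm, ← inner_sub_left]; simp
  linarith

/-- Products of commuting nonnegative operators are nonnegative. -/
theorem inner_mul_apply_self_nonneg {S C : H →L[ℝ] H} (hS : IsSelfAdjoint S)
    (hS1 : ‖1 - S‖ ≤ 1) (hC1 : ‖1 - C‖ ≤ 1) (hCS : Commute C S) (x : H) :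
    0 ≤ ⟪C x, S x⟫ := by
  obtain ⟨R, hR, hRR, -, hRc⟩ := exists_sqrt_of_norm_one_sub_le hS hS1
  have h1 : C (R x) = R (C x) := congrArg (fun f : H →L[ℝ] H => f x) (hRc C hCS).eq
  have h2 : S x = R (R x) := by rw [← hRR]; rfl
  rw [h2, ← inner_apply_comm_of_isSelfAdjoint hR, ← h1]
  exact inner_apply_self_nonneg_of_norm_one_sub_le hC1 _

end Hilbert

/-! ### Resolvents and the square root of an unbounded nonnegative self-adjoint operator -/

section Resolvent

variable {H : Type*} [NormedAddCommGroup H] [InnerProductSpace ℝ H] [CompleteSpace H]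

/-- `Q` is the resolvent `(1 + A)⁻¹` of the nonnegative self-adjoint operator `A`. In particular
the graph of `A` consists of the pairs `(Q w, w - Q w)`. -/
structure IsResolvent (A : H →ₗ.[ℝ] H) (Q : H →L[ℝ] H) : Prop where
  mem_graph : ∀ w, (Q w, w - Q w) ∈ A.graph
  apply_add : ∀ x y, (x, y) ∈ A.graph → Q (x + y) = x
  inner_comm : ∀ x y, ⟪Q x, y⟫ = ⟪x, Q y⟫
  sq_norm_le : ∀ x, ‖Q x‖ ^ 2 ≤ ⟪Q x, x⟫

theorem inner_graph_comm {A : H →ₗ.[ℝ] H} (hA : IsSelfAdjoint A) {x y x' y' : H}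
    (h : (x, y) ∈ A.graph) (h' : (x', y') ∈ A.graph) : ⟪y, x'⟫ = ⟪x, y'⟫ := by
  have hf := LinearPMap.adjoint_isFormalAdjoint hA.dense_domain
  rw [LinearPMap.isSelfAdjoint_def.1 hA] at hf
  obtain ⟨a, rfl, rfl⟩ := (LinearPMap.mem_graph_iff A).1 h
  obtain ⟨b, rfl, rfl⟩ := (LinearPMap.mem_graph_iff A).1 h'
  exact hf a b

theorem inner_graph_nonneg {A : H →ₗ.[ℝ] H} (hA : IsNonneg A) {x y : H}
    (h : (x, y) ∈ A.graph) : 0 ≤ ⟪y, x⟫ := by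
  obtain ⟨a, rfl, rfl⟩ := (LinearPMap.mem_graph_iff A).1 h
  exact hA a

/-- A self-adjoint operator is maximal among its formal adjoints. -/
theorem mem_graph_of_forall_inner {A : H →ₗ.[ℝ] H} (hA : IsSelfAdjoint A) {y z : H}
    (h : ∀ x x', (x, x') ∈ A.graph → ⟪z, x⟫ = ⟪y, x'⟫) : (y, z) ∈ A.graph := by
  have h1 : ∀ x : A.domain, ⟪z, x⟫ = ⟪y, A x⟫ := fun x => h _ _ (A.mem_graph x)
  have h2 : y ∈ A.adjoint.domain := LinearPMap.mem_adjoint_domain_of_exists y ⟨z, h1⟩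
  have h3 : A.adjoint ⟨y, h2⟩ = z := LinearPMap.adjoint_apply_eq hA.dense_domain ⟨y, h2⟩ h1
  have h4 := A.adjoint.mem_graph ⟨y, h2⟩
  rw [h3] at h4
  exact LinearPMap.isSelfAdjoint_def.1 hA ▸ h4

theorem norm_le_norm_add_of_mem_graph {A : H →ₗ.[ℝ] H} (hA : IsNonneg A) {x y : H}
    (h : (x, y) ∈ A.graph) : ‖x‖ ≤ ‖x + y‖ := by
  have h1 := inner_graph_nonneg hA h
  have h2 : ‖x + y‖ ^ 2 = ‖x‖ ^ 2 + 2 * ⟪x, y⟫ + ‖y‖ ^ 2 := norm_add_sq_real x y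
  rw [real_inner_comm] at h1
  nlinarith [norm_nonneg x, norm_nonneg (x + y), sq_nonneg ‖y‖]

/-- The range of `1 + A` is closed because `A` is closed and nonnegative, and it is dense because
`A` is self-adjoint and nonnegative. -/
theorem exists_isResolvent {A : H →ₗ.[ℝ] H} (hA : IsSelfAdjoint A) (hA0 : IsNonneg A) :
    ∃ Q : H →L[ℝ] H, IsResolvent A Q := by
  have hcl : IsClosed (A.graph : Set (H × H)) := hA.isClosed
  have : CompleteSpace A.graph := hcl.completeSpace_coe
  let f : A.graph →L[ℝ] H :=
    (ContinuousLinearMap.fst ℝ H H + ContinuousLinearMap.snd ℝ H H).comp A.graph.subtypeL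
  have hf : ∀ z : A.graph, f z = (z : H × H).1 + (z : H × H).2 := fun z => rfl
  have hanti : AntilipschitzWith 2 f := by
    refine AddMonoidHomClass.antilipschitz_of_bound f fun z => ?_
    obtain ⟨⟨x, y⟩, hz⟩ := z
    have h1 := norm_le_norm_add_of_mem_graph hA0 hz
    have h2 : ‖y‖ ≤ ‖x + y‖ + ‖x‖ := by simpa using norm_sub_le (x + y) x
    rw [hf]
    change max ‖x‖ ‖y‖ ≤ 2 * ‖x + y‖
    refine max_le ?_ ?_ <;> linarith [norm_nonneg x]
  have hrange : f.range = ⊤ := by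
    have hc : IsClosed (f.range : Set H) := hanti.isClosed_range f.uniformContinuous
    have : CompleteSpace f.range := hc.completeSpace_coe
    rw [← Submodule.orthogonal_eq_bot_iff, Submodule.eq_bot_iff]
    intro y hy
    have h1 : (y, -y) ∈ A.graph := by
      refine mem_graph_of_forall_inner hA fun x x' hx => ?_
      have h2 : ⟪x + x', y⟫ = 0 :=
        (Submodule.mem_orthogonal _ _).1 hy _ ⟨⟨(x, x'), hx⟩, rfl⟩
      rw [inner_add_left] at h2
      rw [inner_neg_left, real_inner_comm, real_inner_comm x' y]
      linarith
    have h3 := inner_graph_nonneg hA0 h1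
    rw [inner_neg_left, real_inner_self_eq_norm_sq] at h3
    have : ‖y‖ = 0 := by nlinarith [norm_nonneg y]
    exact norm_eq_zero.1 this
  have hker : f.ker = ⊥ := LinearMap.ker_eq_bot.2 hanti.injective
  let e := ContinuousLinearEquiv.ofBijective f hker hrange
  have he : ∀ w, ((e.symm w : A.graph) : H × H).1 + ((e.symm w : A.graph) : H × H).2 = w :=
    fun w => e.apply_symm_apply w
  let Q : H →L[ℝ] H :=
    ((ContinuousLinearMap.fst ℝ H H).comp A.graph.subtypeL).comp (e.symm : H →L[ℝ] A.graph)
  have hQ : ∀ w, Q w = ((e.symm w : A.graph) : H × H).1 := fun w => rfl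
  have hmem : ∀ w, (Q w, w - Q w) ∈ A.graph := by
    intro w
    have h1 : ((Q w, w - Q w) : H × H) = (e.symm w : A.graph) := by
      refine Prod.ext rfl ?_
      change w - Q w = _
      rw [hQ, sub_eq_iff_eq_add', he]
    rw [h1]
    exact (e.symm w).2
  refine ⟨Q, hmem, ?_, ?_, ?_⟩
  · intro x y hxy
    have h1 : e.symm (x + y) = ⟨(x, y), hxy⟩ := by
      rw [ContinuousLinearEquiv.symm_apply_eq]; rfl
    rw [hQ, h1]
  · intro x y
    have h1 := inner_graph_comm hA (hmem x) (hmem y)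
    rw [inner_sub_left, inner_sub_right] at h1
    linarith
  · intro x
    have h1 := inner_graph_nonneg hA0 (hmem x)
    rw [inner_sub_left, real_inner_self_eq_norm_sq, real_inner_comm] at h1
    linarith

namespace IsResolvent

variable {A : H →ₗ.[ℝ] H} {Q : H →L[ℝ] H} (hQ : IsResolvent A Q)
include hQ

theorem isSelfAdjoint : IsSelfAdjoint Q := isSelfAdjoint_of_inner_apply_comm hQ.inner_comm

theorem injective : Function.Injective Q := by
  rw [injective_iff_map_eq_zero]
  intro w hw
  have h1 := hQ.mem_graph w
  rw [hw, sub_zero] at h1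
  exact A.graph_fst_eq_zero_snd h1 rfl

theorem norm_apply_le (x : H) : ‖Q x‖ ≤ ‖x‖ := by
  have h1 := hQ.sq_norm_le x
  have h2 := real_inner_le_norm (Q x) x
  by_contra! h
  nlinarith [norm_nonneg x]

theorem norm_one_sub_le : ‖1 - Q‖ ≤ 1 := by
  refine ContinuousLinearMap.opNorm_le_bound _ zero_le_one fun x => ?_
  have h1 := hQ.sq_norm_le x
  have h2 : ‖x - Q x‖ ^ 2 = ‖x‖ ^ 2 - 2 * ⟪x, Q x⟫ + ‖Q x‖ ^ 2 := norm_sub_sq_real x (Q x)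
  rw [real_inner_comm] at h1
  change ‖x - Q x‖ ≤ 1 * ‖x‖
  rw [one_mul]
  refine le_of_sq_le_sq ?_ (norm_nonneg _)
  nlinarith [sq_nonneg ‖Q x‖]

theorem norm_le_one : ‖Q‖ ≤ 1 :=
  ContinuousLinearMap.opNorm_le_bound _ zero_le_one fun x => by
    simpa using hQ.norm_apply_le x

end IsResolvent

/-- With `Q = (1 + A)⁻¹`, `S = √Q` and `C = √(1 - Q)`, the square root of `A` is `C S⁻¹`, that is,
its graph consists of the pairs `(S w, C w)`. -/
theorem exists_isNonnegSqrt {A : H →ₗ.[ℝ] H} (hA : IsSelfAdjoint A) (hA0 : IsNonneg A) :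
    ∃ B : H →ₗ.[ℝ] H, IsNonnegSqrt A B := by
  obtain ⟨Q, hQ⟩ := exists_isResolvent hA hA0
  obtain ⟨S, hS, hSS, hS1, hSc⟩ :=
    exists_sqrt_of_norm_one_sub_le hQ.isSelfAdjoint hQ.norm_one_sub_le
  obtain ⟨C, hC, hCC, hC1, hCc⟩ :=
    exists_sqrt_of_norm_one_sub_le ((IsSelfAdjoint.one _).sub hQ.isSelfAdjoint)
      (T := 1 - Q) (by simpa using hQ.norm_le_one)
  have hSQ : Commute S Q := by rw [← hSS]; exact (Commute.refl S).mul_right (Commute.refl S)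
  have hSC : Commute S C := hCc S ((Commute.one_right S).sub_right hSQ)
  have hcomm : ∀ x, S (C x) = C (S x) := fun x => congrArg (fun f : H →L[ℝ] H => f x) hSC.eq
  have hSS' : ∀ x, S (S x) = Q x := fun x => congrArg (fun f : H →L[ℝ] H => f x) hSS
  have hCC' : ∀ x, C (C x) = x - Q x := fun x => congrArg (fun f : H →L[ℝ] H => f x) hCC
  have hSinj : Function.Injective S := by
    intro x y hxy
    apply hQ.injective
    rw [← hSS', ← hSS', hxy]
  have hSsym := inner_apply_comm_of_isSelfAdjoint hS
  have hCsym := inner_apply_comm_of_isSelfAdjoint hC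
  -- A pair with `C y = S z` lies in the graph: `w = S y + C z` is its preimage.
  have hkey : ∀ y z, C y = S z → S (S y + C z) = y ∧ C (S y + C z) = z := by
    intro y z h
    constructor
    · rw [map_add, hSS', hcomm, ← h, hCC']; abel
    · rw [map_add, ← hcomm, h, hSS', hCC']; abel
  let e : H ≃ₗ[ℝ] LinearMap.range (S : H →ₗ[ℝ] H) := LinearEquiv.ofInjective (S : H →ₗ[ℝ] H) hSinj
  let B : H →ₗ.[ℝ] H :=
    ⟨LinearMap.range (S : H →ₗ[ℝ] H), (C : H →ₗ[ℝ] H) ∘ₗ (e.symm : _ →ₗ[ℝ] H)⟩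
  have hBapp : ∀ (w : H) (hw : S w ∈ B.domain), B ⟨S w, hw⟩ = C w := by
    intro w hw
    have h1 : e.symm ⟨S w, hw⟩ = w := by
      rw [LinearEquiv.symm_apply_eq]; rfl
    change C (e.symm ⟨S w, hw⟩) = C w
    rw [h1]
  have hBg : ∀ x y, (x, y) ∈ B.graph ↔ ∃ w, S w = x ∧ C w = y := by
    intro x y
    rw [LinearPMap.mem_graph_iff]
    constructor
    · rintro ⟨⟨a, w, rfl⟩, h1, h2⟩
      exact ⟨w, h1, (hBapp w ⟨w, rfl⟩).symm.trans h2⟩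
    · rintro ⟨w, rfl, rfl⟩
      exact ⟨⟨S w, w, rfl⟩, rfl, hBapp w ⟨w, rfl⟩⟩
  have hdense : Dense (B.domain : Set H) := by
    have h1 : (B.domain : Set H) = Set.range S := by
      ext; rfl
    rw [show (B.domain : Set H) = (B.domain : Submodule ℝ H) from rfl,
      Submodule.dense_iff_topologicalClosure_eq_top,
      Submodule.topologicalClosure_eq_top_iff, Submodule.eq_bot_iff]
    intro v hv
    apply hSinj
    rw [map_zero]
    refine ext_inner_left ℝ fun w => ?_
    rw [← hSsym, inner_zero_right]
    exact (Submodule.mem_orthogonal _ _).1 hv _ ⟨w, rfl⟩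
  have hBsa : IsSelfAdjoint B := by
    have hform : B.IsFormalAdjoint B := by
      rintro ⟨_, a, rfl⟩ ⟨_, b, rfl⟩
      erw [hBapp a ⟨a, rfl⟩, hBapp b ⟨b, rfl⟩]
      change ⟪C a, S b⟫ = ⟪S a, C b⟫
      rw [hSsym, hcomm, hCsym]
    rw [LinearPMap.isSelfAdjoint_def]
    refine le_antisymm ?_ (hform.le_adjoint hdense)
    rw [← LinearPMap.le_graph_iff]
    rintro ⟨y, z⟩ hyz
    rw [LinearPMap.mem_graph_iff] at hyz
    obtain ⟨a, rfl, rfl⟩ := hyz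
    have h1 := LinearPMap.adjoint_isFormalAdjoint hdense a
    have h2 : C (a : H) = S (B.adjoint a) := by
      refine ext_inner_right ℝ fun x => ?_
      have h3 := h1 ⟨S x, x, rfl⟩
      rw [hBapp x ⟨x, rfl⟩] at h3
      rw [hCsym, hSsym]
      exact h3.symm
    obtain ⟨h3, h4⟩ := hkey _ _ h2
    exact (hBg _ _).2 ⟨_, h3, h4⟩
  refine ⟨B, hBsa, ?_, ?_⟩
  · rintro ⟨_, a, rfl⟩
    erw [hBapp a ⟨a, rfl⟩]
    exact inner_mul_apply_self_nonneg hS hS1 hC1 hSC.symm a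
  · intro x y
    constructor
    · intro h
      have h1 := hQ.apply_add x y h
      refine ⟨C (S (x + y)), (hBg _ _).2 ⟨S (x + y), ?_, rfl⟩,
        (hBg _ _).2 ⟨C (x + y), hcomm _, ?_⟩⟩
      · rw [hSS', h1]
      · rw [hCC', h1]; abel
    · rintro ⟨z, hxz, hzy⟩
      obtain ⟨a, rfl, rfl⟩ := (hBg _ _).1 hxz
      obtain ⟨b, hb, rfl⟩ := (hBg _ _).1 hzy
      obtain ⟨h1, h2⟩ := hkey a b hb.symm
      have h3 := hQ.mem_graph (S a + C b)
      rwa [← hCC', ← hSS', h1, h2] at h3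

end Resolvent

/-! ### The unitary group generated by a skew-adjoint operator with bounded inverse -/

section Group

variable {X : Type*} [NormedAddCommGroup X] [InnerProductSpace ℝ X] [CompleteSpace X]

/-- `U` is the strongly continuous group of isometries generated by the (in general unbounded)
operator `M⁻¹`, where `M` is an injective bounded operator. Only the part of the group law
that says `U(-t) = U(t)⁻¹` is recorded. -/
structure IsGroupGeneratedByInv (M : X →L[ℝ] X) (U : ℝ → X →L[ℝ] X) : Prop where
  norm_map : ∀ t x, ‖U t x‖ = ‖x‖
  neg_apply : ∀ t x, U (-t) (U t x) = x
  comm : ∀ t x, U t (M x) = M (U t x)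
  continuous : ∀ x, Continuous fun t => U t x
  hasDerivAt : ∀ x t, HasDerivAt (fun t => U t (M x)) (U t x) t

theorem norm_exp_smul_apply {D : X →L[ℝ] X} (hD : D ∈ skewAdjoint (X →L[ℝ] X)) (t : ℝ) (x : X) :
    ‖NormedSpace.exp (t • D) x‖ = ‖x‖ := by
  let : NormedAlgebra ℚ (X →L[ℝ] X) := NormedAlgebra.restrictScalars ℚ ℝ (X →L[ℝ] X)
  have h1 : t • D ∈ skewAdjoint (X →L[ℝ] X) := by
    rw [skewAdjoint.mem_iff, star_smul, skewAdjoint.mem_iff.1 hD, smul_neg, star_trivial]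
  have h2 : NormedSpace.exp (t • D) ∈ unitary (X →L[ℝ] X) :=
    NormedSpace.exp_mem_unitary_of_mem_skewAdjoint h1
  exact ContinuousLinearMap.norm_map_of_mem_unitary h2 x

theorem hasDerivAt_exp_smul_apply (D : X →L[ℝ] X) (t : ℝ) (x : X) :
    HasDerivAt (fun s : ℝ => NormedSpace.exp (s • D) x) (NormedSpace.exp (t • D) (D x)) t :=
  (hasDerivAt_exp_smul_const D t).clm_apply (hasDerivAt_const t x) |>.congr_deriv (by simp)

theorem norm_exp_smul_apply_sub_le {D : X →L[ℝ] X} (hD : D ∈ skewAdjoint (X →L[ℝ] X)) (s t : ℝ)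
    (x : X) :
    ‖NormedSpace.exp (t • D) x - NormedSpace.exp (s • D) x‖ ≤ ‖D x‖ * |t - s| := by
  refine Convex.norm_image_sub_le_of_norm_hasDerivWithin_le (s := univ)
    (f := fun t : ℝ => NormedSpace.exp (t • D) x)
    (fun r _ => (hasDerivAt_exp_smul_apply D r x).hasDerivWithinAt)
    (fun r _ => (norm_exp_smul_apply hD r (D x)).le) convex_univ (mem_univ s) (mem_univ t)

/-- For commuting skew-adjoint `D` and `D'`, `exp (tD) x - exp (tD') x` is controlled by
`(D - D') x` alone. -/
theorem norm_exp_smul_apply_sub_exp_smul_apply_le {D D' : X →L[ℝ] X}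
    (hD : D ∈ skewAdjoint (X →L[ℝ] X)) (hD' : D' ∈ skewAdjoint (X →L[ℝ] X)) (hc : Commute D D')
    (t : ℝ) (x : X) :
    ‖NormedSpace.exp (t • D) x - NormedSpace.exp (t • D') x‖ ≤ |t| * ‖D x - D' x‖ := by
  let : NormedAlgebra ℚ (X →L[ℝ] X) := NormedAlgebra.restrictScalars ℚ ℝ (X →L[ℝ] X)
  have h1 : NormedSpace.exp (t • D) = NormedSpace.exp (t • D') * NormedSpace.exp (t • (D - D')) := by
    rw [← NormedSpace.exp_add_of_commute]
    · congr 1; module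
    · exact ((hc.symm.sub_right (Commute.refl D')).smul_right t).smul_left t
  have h2 := norm_exp_smul_apply_sub_le (sub_mem hD hD') 0 t x
  rw [zero_smul, NormedSpace.exp_zero, sub_zero] at h2
  rw [h1, mul_apply_eq_comp, ← map_sub, norm_exp_smul_apply hD', mul_comm]
  exact h2

section

variable {M : X →L[ℝ] X} (hM : ∀ x y, ⟪M x, y⟫ = -⟪x, M y⟫)
include hM

theorem denseRange_of_skew (hinj : Function.Injective M) : DenseRange M := by
  have h1 : (range M) = ((LinearMap.range (M : X →ₗ[ℝ] X) : Submodule ℝ X) : Set X) := by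
    ext; rfl
  rw [DenseRange, h1, Submodule.dense_iff_topologicalClosure_eq_top,
    Submodule.topologicalClosure_eq_top_iff, Submodule.eq_bot_iff]
  intro v hv
  apply hinj
  rw [map_zero]
  refine ext_inner_left ℝ fun w => ?_
  have h2 : ⟪M w, v⟫ = 0 := (Submodule.mem_orthogonal _ _).1 hv _ ⟨w, rfl⟩
  rw [inner_zero_right]
  linarith [hM w v]

/-- The inverse of `ε - M² = ε + M* M`. -/
theorem exists_inverse_smul_one_sub_sq {ε : ℝ} (hε : 0 < ε) :
    ∃ P : X →L[ℝ] X, (∀ x, ε • P x - M (M (P x)) = x) ∧ (∀ x y, ⟪P x, y⟫ = ⟪x, P y⟫) ∧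
      (∀ x, ε * ‖P x‖ ≤ ‖x‖) ∧ ∀ C : X →L[ℝ] X, Commute C M → Commute C P := by
  set T : X →L[ℝ] X := ε • 1 - M * M with hT
  have hTapp : ∀ x, T x = ε • x - M (M x) := fun x => rfl
  have hTin : ∀ x, ⟪T x, x⟫ = ε * ‖x‖ ^ 2 + ‖M x‖ ^ 2 := by
    intro x
    rw [hTapp, inner_sub_left, real_inner_smul_left, hM (M x) x, real_inner_self_eq_norm_sq,
      real_inner_self_eq_norm_sq]
    ring
  have hTsym : ∀ x y, ⟪T x, y⟫ = ⟪x, T y⟫ := by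
    intro x y
    rw [hTapp, hTapp, inner_sub_left, inner_sub_right, real_inner_smul_left, real_inner_smul_right,
      hM, hM]
    ring
  have hunit : IsUnit T := by
    refine ContinuousLinearMap.isUnit_of_forall_le_norm_inner_map T (c := ⟨ε, hε.le⟩) hε fun x => ?_
    rw [hTin, Real.norm_of_nonneg (by positivity)]
    change ‖x‖ ^ 2 * ε ≤ _
    nlinarith [sq_nonneg ‖M x‖]
  obtain ⟨u, hu⟩ := hunit
  have hr : ∀ x, T ((↑u⁻¹ : X →L[ℝ] X) x) = x := fun x => by
    rw [← hu]
    exact congrArg (fun f : X →L[ℝ] X => f x) u.mul_inv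
  refine ⟨↑u⁻¹, fun x => by rw [← hTapp, hr], fun x y => ?_, fun x => ?_, fun C hC => ?_⟩
  · conv_lhs => rw [← hr y]
    rw [← hTsym, hr]
  · set p := (↑u⁻¹ : X →L[ℝ] X) x
    have h1 : ε * ‖p‖ ^ 2 ≤ ‖x‖ * ‖p‖ := by
      have h2 := hTin p
      rw [hr] at h2
      have h3 := real_inner_le_norm x p
      nlinarith [sq_nonneg ‖M p‖]
    rcases (norm_nonneg p).eq_or_lt with h0 | h0
    · rw [← h0]; simp
    · nlinarith
  · have h1 : Commute C (u : X →L[ℝ] X) := by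
      rw [hu]
      exact ((Commute.one_right C).smul_right ε).sub_right (hC.mul_right hC)
    exact h1.units_inv_right

/-- The operators `A ε = -M (ε - M²)⁻¹` are commuting bounded skew-adjoint approximations of
`M⁻¹`, and `exp (t A ε)` converges strongly as `ε → 0` because it does so on the dense range
of `M³`. -/
theorem exists_isGroupGeneratedByInv (hinj : Function.Injective M) :
    ∃ U : ℝ → X →L[ℝ] X, IsGroupGeneratedByInv M U := by
  let ε : ℕ → ℝ := fun n => 1 / ((n : ℝ) + 1)
  have hε : ∀ n, 0 < ε n := fun n => by positivity
  have hεlim : Tendsto ε atTop (𝓝 0) := tendsto_one_div_add_atTop_nhds_zero_nat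
  choose P hP hPsym hPle hPc using fun n => exists_inverse_smul_one_sub_sq hM (hε n)
  have hPM : ∀ n x, P n (M x) = M (P n x) := fun n x =>
    (congrArg (fun f : X →L[ℝ] X => f x) (hPc n M (Commute.refl M)).eq).symm
  let A : ℕ → X →L[ℝ] X := fun n => -(M * P n)
  have hAapp : ∀ n x, A n x = -M (P n x) := fun n x => rfl
  have hAskew : ∀ n, A n ∈ skewAdjoint (X →L[ℝ] X) := by
    intro n
    rw [skewAdjoint.mem_iff, ContinuousLinearMap.star_eq_adjoint]
    symm
    rw [ContinuousLinearMap.eq_adjoint_iff]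
    intro x y
    rw [neg_apply, hAapp, hAapp, neg_neg, hM, hPsym, hPM, inner_neg_right]
  have hAcomm : ∀ n m, Commute (A n) (A m) := by
    intro n m
    have h1 : Commute M (P n) := hPc n M (Commute.refl M)
    have h2 : Commute M (P m) := hPc m M (Commute.refl M)
    have h3 : Commute (P n) (P m) := hPc m (P n) h1.symm
    exact (((Commute.refl M).mul_right h2).mul_left (h1.symm.mul_right h3)).neg_left.neg_right
  have hAM : ∀ n x, A n (M x) = x - ε n • P n x := by
    intro n x
    rw [hAapp, hPM]
    nth_rewrite 2 [← hP n x]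
    abel
  have hAMle : ∀ n x, ‖A n (M x)‖ ≤ 2 * ‖x‖ := by
    intro n x
    rw [hAM]
    refine (norm_sub_le _ _).trans ?_
    rw [norm_smul, Real.norm_of_nonneg (hε n).le]
    linarith [hPle n x]
  -- on the range of `M³` the approximations converge at the rate `ε`
  have hA3 : ∀ n x, ‖A n (M (M (M x))) - M (M x)‖ ≤ 2 * ‖x‖ * ε n := by
    intro n x
    have h1 : P n (M (M x)) = ε n • P n x - x := by
      rw [hPM, hPM]
      nth_rewrite 3 [← hP n x]
      abel
    rw [hAM, sub_sub_cancel_left, norm_neg, norm_smul, Real.norm_of_nonneg (hε n).le, h1, mul_comm]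
    refine mul_le_mul_of_nonneg_right ?_ (hε n).le
    refine (norm_sub_le _ _).trans ?_
    rw [norm_smul, Real.norm_of_nonneg (hε n).le]
    linarith [hPle n x]
  have hdense1 : DenseRange M := denseRange_of_skew hM hinj
  have hdense3 : DenseRange fun x => M (M (M x)) :=
    (hdense1.comp (hdense1.comp hdense1 M.continuous) M.continuous)
  let V : ℕ → ℝ → X →L[ℝ] X := fun n t => NormedSpace.exp (t • A n)
  have hVnorm : ∀ n t x, ‖V n t x‖ = ‖x‖ := fun n t x => norm_exp_smul_apply (hAskew n) t x
  have hVneg : ∀ n t x, V n (-t) (V n t x) = x := by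
    intro n t x
    let : NormedAlgebra ℚ (X →L[ℝ] X) := NormedAlgebra.restrictScalars ℚ ℝ (X →L[ℝ] X)
    have h1 : V n (-t) * V n t = 1 := by
      change NormedSpace.exp (-t • A n) * NormedSpace.exp (t • A n) = 1
      rw [← NormedSpace.exp_add_of_commute
        (((Commute.refl (A n)).smul_left (-t)).smul_right t)]
      simp
    exact congrArg (fun f : X →L[ℝ] X => f x) h1
  have hVcomm : ∀ n t x, V n t (M x) = M (V n t x) := by
    intro n t x
    have h0 : Commute M (P n) := hPc n M (Commute.refl M)
    have h1 : Commute M (A n) := ((Commute.refl M).mul_right h0).neg_right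
    have h2 : Commute M (V n t) := (h1.smul_right t).exp_right
    exact (congrArg (fun f : X →L[ℝ] X => f x) h2.eq).symm
  have hcauchy : ∀ t x, CauchySeq fun n => V n t x := by
    intro t x
    rw [Metric.cauchySeq_iff']
    intro δ hδ
    obtain ⟨w, hw⟩ := hdense3.exists_dist_lt x (show 0 < δ / 4 by positivity)
    have hlim : Tendsto (fun n => |t| * (2 * ‖w‖ * ε n)) atTop (𝓝 0) := by
      simpa using (hεlim.const_mul (2 * ‖w‖)).const_mul |t|
    obtain ⟨N, hN⟩ := eventually_atTop.1 (hlim.eventually (gt_mem_nhds (show 0 < δ / 4 by positivity)))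
    refine ⟨N, fun n hn => ?_⟩
    set z := M (M (M w)) with hz
    have h1 : ‖V n t z - V N t z‖ < δ / 2 := by
      refine (norm_exp_smul_apply_sub_exp_smul_apply_le (hAskew n) (hAskew N) (hAcomm n N) t z).trans_lt
        ?_
      have h2 : ‖A n z - A N z‖ ≤ 2 * ‖w‖ * ε n + 2 * ‖w‖ * ε N := by
        have h3 : A n z - A N z = (A n z - M (M w)) - (A N z - M (M w)) := by abel
        rw [h3]
        exact (norm_sub_le _ _).trans (add_le_add (hA3 n w) (hA3 N w))
      have h4 := mul_le_mul_of_nonneg_left h2 (abs_nonneg t)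
      have h5 := hN n hn
      have h6 := hN N le_rfl
      linarith
    have h7 : ∀ m, ‖V m t x - V m t z‖ < δ / 4 := by
      intro m
      rw [← map_sub, hVnorm, ← dist_eq_norm]
      exact hw
    rw [dist_eq_norm]
    have h8 : V n t x - V N t x =
        (V n t x - V n t z) + (V n t z - V N t z) - (V N t x - V N t z) := by abel
    rw [h8]
    refine (norm_sub_le _ _).trans_lt ?_
    have h9 := norm_add_le (V n t x - V n t z) (V n t z - V N t z)
    linarith [h7 n, h7 N]
  choose u hu using fun t x => cauchySeq_tendsto_of_complete (hcauchy t x)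
  let U : ℝ → X →L[ℝ] X := fun t =>
    continuousLinearMapOfTendsto (fun n => V n t) (f := u t) (tendsto_pi_nhds.2 (hu t))
  have hU : ∀ t x, Tendsto (fun n => V n t x) atTop (𝓝 (U t x)) := hu
  have hUseq : ∀ t (y : ℕ → X) (x : X), Tendsto y atTop (𝓝 x) →
      Tendsto (fun n => V n t (y n)) atTop (𝓝 (U t x)) := by
    intro t y x hy
    have h1 : Tendsto (fun n => V n t (y n - x)) atTop (𝓝 0) := by
      rw [tendsto_zero_iff_norm_tendsto_zero]
      simp_rw [hVnorm]
      rw [← tendsto_zero_iff_norm_tendsto_zero]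
      simpa using hy.sub_const x
    have h2 := h1.add (hU t x)
    simpa using h2
  have hAMlim : ∀ x, Tendsto (fun n => A n (M x)) atTop (𝓝 x) := by
    intro x
    -- `ε P ε` is bounded and tends to zero on the dense range of `M²`
    rw [Metric.tendsto_atTop]
    intro δ hδ
    have hdense2 : DenseRange fun x => M (M x) := hdense1.comp hdense1 M.continuous
    obtain ⟨w, hw⟩ := hdense2.exists_dist_lt x (show 0 < δ / 2 by positivity)
    have hlim : Tendsto (fun n => 2 * ‖w‖ * ε n) atTop (𝓝 0) := by
      simpa using hεlim.const_mul (2 * ‖w‖)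
    obtain ⟨N, hN⟩ := eventually_atTop.1 (hlim.eventually (gt_mem_nhds (show 0 < δ / 2 by positivity)))
    refine ⟨N, fun n hn => ?_⟩
    have h1 : A n (M x) - x = (A n (M (M (M w))) - M (M w)) - ε n • P n (x - M (M w)) := by
      rw [hAM, hAM, map_sub]; module
    have h2 : ‖ε n • P n (x - M (M w))‖ < δ / 2 := by
      rw [norm_smul, Real.norm_of_nonneg (hε n).le]
      refine (hPle n _).trans_lt ?_
      rwa [← dist_eq_norm]
    rw [dist_eq_norm, h1]
    refine (norm_sub_le _ _).trans_lt ?_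
    linarith [hA3 n w, hN n hn]
  have hUnorm : ∀ t x, ‖U t x‖ = ‖x‖ := fun t x =>
    tendsto_nhds_unique (hU t x).norm (by simp_rw [hVnorm]; exact tendsto_const_nhds)
  have hUcont : ∀ x, Continuous fun t => U t x := by
    have hLip : ∀ x s t, ‖U t (M x) - U s (M x)‖ ≤ 2 * ‖x‖ * |t - s| := by
      intro x s t
      refine le_of_tendsto ((hU t (M x)).sub (hU s (M x))).norm (Eventually.of_forall fun n => ?_)
      refine (norm_exp_smul_apply_sub_le (hAskew n) s t (M x)).trans ?_
      exact mul_le_mul_of_nonneg_right (hAMle n x) (abs_nonneg _)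
    intro x
    rw [Metric.continuous_iff]
    intro t δ hδ
    obtain ⟨w, hw⟩ := hdense1.exists_dist_lt x (show 0 < δ / 3 by positivity)
    rw [dist_eq_norm] at hw
    refine ⟨δ / (3 * (2 * ‖w‖ + 1)), by positivity, fun s hs => ?_⟩
    have h1 : 2 * ‖w‖ * |s - t| ≤ δ / 3 := by
      have h2 : |s - t| ≤ δ / (3 * (2 * ‖w‖ + 1)) := by
        rw [← Real.dist_eq]; exact hs.le
      calc 2 * ‖w‖ * |s - t| ≤ (2 * ‖w‖ + 1) * (δ / (3 * (2 * ‖w‖ + 1))) := by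
            gcongr; linarith
        _ = δ / 3 := by field_simp
    have h3 : U s x - U t x = U s (x - M w) + (U s (M w) - U t (M w)) - U t (x - M w) := by
      rw [map_sub, map_sub]; abel
    rw [dist_eq_norm, h3]
    refine (norm_sub_le _ _).trans_lt ?_
    have h4 := norm_add_le (U s (x - M w)) (U s (M w) - U t (M w))
    rw [hUnorm] at h4 ⊢
    linarith [hLip w t s]
  refine ⟨U, hUnorm, fun t x => ?_, fun t x => ?_, hUcont, fun x t => ?_⟩
  · refine tendsto_nhds_unique (hU (-t) (U t x)) ?_
    rw [tendsto_iff_norm_sub_tendsto_zero]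
    have h1 : ∀ n, ‖V n (-t) (U t x) - x‖ = ‖U t x - V n t x‖ := by
      intro n
      nth_rewrite 2 [← hVneg n t x]
      rw [← map_sub, hVnorm]
    simp_rw [h1]
    have h2 := ((hU t x).const_sub (U t x)).norm
    simpa using h2
  · refine tendsto_nhds_unique (hU t (M x)) ?_
    simp_rw [hVcomm]
    exact (M.continuous.tendsto _).comp (hU t x)
  · have hint : ∀ t, U t (M x) = M x + ∫ s in (0 : ℝ)..t, U s x := by
      intro t
      have hn : ∀ n, V n t (M x) = M x + ∫ s in (0 : ℝ)..t, V n s (A n (M x)) := by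
        intro n
        have hc : Continuous fun s => V n s (A n (M x)) :=
          continuous_iff_continuousAt.2 fun s =>
            (hasDerivAt_exp_smul_apply (A n) s (A n (M x))).continuousAt
        rw [intervalIntegral.integral_eq_sub_of_hasDerivAt
          (fun s _ => hasDerivAt_exp_smul_apply (A n) s (M x)) (hc.intervalIntegrable _ _)]
        simp [V]
      refine tendsto_nhds_unique (hU t (M x)) ?_
      simp_rw [hn]
      refine tendsto_const_nhds.add ?_
      refine intervalIntegral.tendsto_integral_filter_of_dominated_convergence
        (fun _ => 2 * ‖x‖) (Eventually.of_forall fun n => ?_) (Eventually.of_forall fun n => ?_)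
        intervalIntegrable_const ?_
      · have hc : Continuous fun s => V n s (A n (M x)) :=
          continuous_iff_continuousAt.2 fun s =>
            (hasDerivAt_exp_smul_apply (A n) s (A n (M x))).continuousAt
        exact hc.aestronglyMeasurable
      · refine MeasureTheory.ae_of_all _ fun s _ => ?_
        rw [hVnorm]
        exact hAMle n x
      · exact MeasureTheory.ae_of_all _ fun s _ => hUseq s _ _ (hAMlim x)
    have h1 : (fun t => U t (M x)) = fun t => M x + ∫ s in (0 : ℝ)..t, U s x := funext hint
    rw [h1]
    exact ((hUcont x).integral_hasStrictDerivAt 0 t).hasDerivAt.const_add _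

end

end Group

/-! ### Curves along the group -/

section GroupCurves

variable {X : Type*} [NormedAddCommGroup X] [InnerProductSpace ℝ X] [CompleteSpace X]

namespace IsGroupGeneratedByInv

variable {M : X →L[ℝ] X} {U : ℝ → X →L[ℝ] X} (hU : IsGroupGeneratedByInv M U)
include hU

theorem neg : IsGroupGeneratedByInv (-M) fun t => U (-t) where
  norm_map t x := hU.norm_map _ x
  neg_apply t x := hU.neg_apply _ x
  comm t x := by simp [hU.comm]
  continuous x := (hU.continuous x).comp continuous_neg
  hasDerivAt x t := by
    have h1 := (hU.hasDerivAt x (-t)).scomp t (hasDerivAt_neg t)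
    have h2 := h1.neg
    simpa [Function.comp_def] using! h2

theorem apply_neg_apply (t : ℝ) (x : X) : U t (U (-t) x) = x := by
  simpa using hU.neg_apply (-t) x

theorem inner_map (t : ℝ) (x y : X) : ⟪U t x, U t y⟫ = ⟪x, y⟫ :=
  LinearIsometry.inner_map_map (⟨(U t : X →ₗ[ℝ] X), hU.norm_map t⟩ : X →ₗᵢ[ℝ] X) x y

theorem tendsto_apply {ι : Type*} {l : Filter ι} {σ : ι → ℝ} {f : ι → X} {t : ℝ} {x : X}
    (hσ : Tendsto σ l (𝓝 t)) (hf : Tendsto f l (𝓝 x)) :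
    Tendsto (fun i => U (σ i) (f i)) l (𝓝 (U t x)) := by
  have h1 : Tendsto (fun i => U (σ i) (f i - x)) l (𝓝 0) := by
    rw [tendsto_zero_iff_norm_tendsto_zero]
    simp_rw [hU.norm_map]
    rw [← tendsto_zero_iff_norm_tendsto_zero]
    simpa using hf.sub_const x
  have h2 := h1.add (((hU.continuous x).tendsto t).comp hσ)
  simpa using h2

theorem continuousOn_apply {f : ℝ → X} {s : Set ℝ} (hf : ContinuousOn f s) :
    ContinuousOn (fun t => U t (f t)) s :=
  fun t ht => hU.tendsto_apply (tendsto_id.mono_left nhdsWithin_le_nhds) (hf t ht)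

/-- The product rule for `U t (f t)`, at a time `t` at which `f t = M ξ` belongs to the domain of
the generator. -/
theorem hasDerivWithinAt_apply {f : ℝ → X} {f' ξ : X} {s : Set ℝ} {t : ℝ}
    (hf : HasDerivWithinAt f f' s t) (hξ : f t = M ξ) :
    HasDerivWithinAt (fun τ => U τ (f τ)) (U t f' + U t ξ) s t := by
  have h1 : HasDerivWithinAt (fun τ => U τ (f τ - f t)) (U t f') s t := by
    rw [hasDerivWithinAt_iff_tendsto_slope]
    have h2 : slope (fun τ => U τ (f τ - f t)) t = fun τ => U τ (slope f t τ) := by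
      funext τ
      simp [slope_def_module]
    rw [h2]
    exact hU.tendsto_apply (tendsto_id.mono_left nhdsWithin_le_nhds)
      (hasDerivWithinAt_iff_tendsto_slope.1 hf)
  have h3 : (fun τ => U τ (f τ)) = fun τ => U τ (f τ - f t) + U τ (M ξ) := by
    funext τ
    rw [← hξ, ← map_add, sub_add_cancel]
  rw [h3]
  exact h1.add (hU.hasDerivAt ξ t).hasDerivWithinAt

end IsGroupGeneratedByInv

/-- The fundamental theorem of calculus on `[0, T]`, for a continuous integrand. -/
theorem exists_hasDerivWithinAt_of_continuousOn {k : ℝ → X} {T : ℝ} (hT : 0 ≤ T)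
    (hk : ContinuousOn k (Icc 0 T)) (x₀ : X) :
    ∃ K : ℝ → X, K 0 = x₀ ∧ ∀ t ∈ Icc 0 T, HasDerivWithinAt K (k t) (Icc 0 T) t := by
  have hc : Continuous (IccExtend hT ((Icc 0 T).domRestrict k)) :=
    (continuousOn_iff_continuous_domRestrict.1 hk).Icc_extend'
  refine ⟨fun t => x₀ + ∫ s in (0 : ℝ)..t, IccExtend hT ((Icc 0 T).domRestrict k) s, by simp,
    fun t ht => ?_⟩
  have h1 := (hc.integral_hasStrictDerivAt 0 t).hasDerivAt.const_add x₀
  rw [IccExtend_of_mem hT _ ht] at h1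
  exact h1.hasDerivWithinAt

theorem eqOn_of_hasDerivWithinAt_eq {f g f' : ℝ → X} {T : ℝ}
    (hf : ∀ t ∈ Icc 0 T, HasDerivWithinAt f (f' t) (Icc 0 T) t)
    (hg : ∀ t ∈ Icc 0 T, HasDerivWithinAt g (f' t) (Icc 0 T) t) (h0 : f 0 = g 0) :
    EqOn f g (Icc 0 T) := by
  intro t ht
  have hT : (0 : ℝ) ∈ Icc 0 T := ⟨le_rfl, ht.1.trans ht.2⟩
  have h1 := Convex.norm_image_sub_le_of_norm_hasDerivWithin_le (C := 0)
    (fun s hs => (hf s hs).sub (hg s hs)) (fun s _ => by simp) (convex_Icc 0 T) hT ht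
  rw [zero_mul, norm_le_zero_iff] at h1
  have h2 : f t - g t = f 0 - g 0 := sub_eq_zero.1 h1
  rwa [h0, sub_self, sub_eq_zero] at h2

/-- If `M w` has the derivative `M k` with `k` continuous and `M` is injective, then `w` has the
derivative `k`. -/
theorem hasDerivWithinAt_of_map {M : X →L[ℝ] X} (hM : Function.Injective M) {w k : ℝ → X} {T : ℝ}
    (hk : ContinuousOn k (Icc 0 T))
    (hw : ∀ t ∈ Icc 0 T, HasDerivWithinAt (fun τ => M (w τ)) (M (k t)) (Icc 0 T) t) :
    ∀ t ∈ Icc 0 T, HasDerivWithinAt w (k t) (Icc 0 T) t := by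
  intro t ht
  obtain ⟨K, hK0, hK⟩ := exists_hasDerivWithinAt_of_continuousOn (ht.1.trans ht.2) hk (w 0)
  have h1 : EqOn (fun τ => M (w τ)) (fun τ => M (K τ)) (Icc 0 T) :=
    eqOn_of_hasDerivWithinAt_eq hw
      (fun s hs => M.hasFDerivAt.comp_hasDerivWithinAt s (hK s hs)) (by simp [hK0])
  have h2 : EqOn w K (Icc 0 T) := fun s hs => hM (h1 hs)
  exact (hK t ht).congr h2 (h2 ht)

end GroupCurves

/-! ### The first-order wave system -/

section Wave

variable {H : Type*} [NormedAddCommGroup H] [InnerProductSpace ℝ H] [CompleteSpace H]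

/-- The bounded operator `(x, y) ↦ (-Q y, Q x)` on `H ⊕ H`. For `Q = (1 + B)⁻¹` it is the inverse of
the generator `(x, y) ↦ ((1 + B) y, -(1 + B) x)` of the wave group. -/
def waveInv (Q : H →L[ℝ] H) : WithLp 2 (H × H) →L[ℝ] WithLp 2 (H × H) :=
  ((WithLp.prodContinuousLinearEquiv 2 ℝ H H).symm : H × H →L[ℝ] WithLp 2 (H × H)) ∘L
    ((-(Q ∘L ContinuousLinearMap.snd ℝ H H)).prod (Q ∘L ContinuousLinearMap.fst ℝ H H)) ∘L
    ((WithLp.prodContinuousLinearEquiv 2 ℝ H H) : WithLp 2 (H × H) →L[ℝ] H × H)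

theorem waveInv_apply (Q : H →L[ℝ] H) (z : WithLp 2 (H × H)) :
    waveInv Q z = WithLp.toLp 2 (-Q z.snd, Q z.fst) := rfl

theorem waveInv_injective {Q : H →L[ℝ] H} (hQ : Function.Injective Q) :
    Function.Injective (waveInv Q) := by
  rw [injective_iff_map_eq_zero]
  intro z hz
  rw [waveInv_apply] at hz
  have h1 : -Q z.snd = 0 := congrArg (fun z : WithLp 2 (H × H) => z.fst) hz
  have h2 : Q z.fst = 0 := congrArg (fun z : WithLp 2 (H × H) => z.snd) hz
  have h3 : z.snd = 0 := hQ (by rw [map_zero]; exact neg_eq_zero.1 h1)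
  have h4 : z.fst = 0 := hQ (by rw [map_zero]; exact h2)
  exact (WithLp.ofLp_injective 2) (Prod.ext h4 h3)

theorem waveInv_skew {Q : H →L[ℝ] H} (hQ : ∀ x y, ⟪Q x, y⟫ = ⟪x, Q y⟫) (z w : WithLp 2 (H × H)) :
    ⟪waveInv Q z, w⟫ = -⟪z, waveInv Q w⟫ := by
  rw [waveInv_apply, waveInv_apply, WithLp.prod_inner_apply, WithLp.prod_inner_apply]
  simp only [inner_neg_left, inner_neg_right]
  have h1 := hQ z.fst w.snd
  have h2 := hQ z.snd w.fst
  simp only [WithLp.fst, WithLp.snd] at *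
  linarith

/-- Solutions on `[0, T]` of `x' = (1 + B) y`, `y' = -(1 + B) x + h`, where `Q = (1 + B)⁻¹` has been
applied to both equations. -/
structure IsWaveCurve (Q : H →L[ℝ] H) (x y h : ℝ → H) (T : ℝ) : Prop where
  cont_x : ContinuousOn x (Icc 0 T)
  cont_y : ContinuousOn y (Icc 0 T)
  cont_h : ContinuousOn h (Icc 0 T)
  deriv_x : ∀ t ∈ Icc 0 T, HasDerivWithinAt (fun τ => Q (x τ)) (y t) (Icc 0 T) t
  deriv_y : ∀ t ∈ Icc 0 T, HasDerivWithinAt (fun τ => Q (y τ)) (-x t + Q (h t)) (Icc 0 T) t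

theorem IsWaveCurve.mono {Q : H →L[ℝ] H} {x y h : ℝ → H} {T T' : ℝ} (hw : IsWaveCurve Q x y h T)
    (hT : T' ≤ T) : IsWaveCurve Q x y h T' where
  cont_x := hw.cont_x.mono (Icc_subset_Icc_right hT)
  cont_y := hw.cont_y.mono (Icc_subset_Icc_right hT)
  cont_h := hw.cont_h.mono (Icc_subset_Icc_right hT)
  deriv_x t ht := (hw.deriv_x t (Icc_subset_Icc_right hT ht)).mono (Icc_subset_Icc_right hT)
  deriv_y t ht := (hw.deriv_y t (Icc_subset_Icc_right hT ht)).mono (Icc_subset_Icc_right hT)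

theorem IsWaveCurve.congr {Q : H →L[ℝ] H} {x y h x' y' h' : ℝ → H} {T : ℝ}
    (hw : IsWaveCurve Q x y h T) (hx : EqOn x' x (Icc 0 T)) (hy : EqOn y' y (Icc 0 T))
    (hh : EqOn h' h (Icc 0 T)) : IsWaveCurve Q x' y' h' T where
  cont_x := hw.cont_x.congr hx
  cont_y := hw.cont_y.congr hy
  cont_h := hw.cont_h.congr hh
  deriv_x t ht := by
    rw [hy ht]
    exact (hw.deriv_x t ht).congr (fun s hs => by simp only [hx hs]) (by simp only [hx ht])
  deriv_y t ht := by
    rw [hx ht, hh ht]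
    exact (hw.deriv_y t ht).congr (fun s hs => by simp only [hy hs]) (by simp only [hy ht])

theorem continuousOn_toLp {x y : ℝ → H} {s : Set ℝ} (hx : ContinuousOn x s)
    (hy : ContinuousOn y s) : ContinuousOn (fun t => WithLp.toLp 2 (x t, y t)) s :=
  (WithLp.prod_continuous_toLp 2 H H).comp_continuousOn (hx.prodMk hy)

section

variable {Q : H →L[ℝ] H} {U : ℝ → WithLp 2 (H × H) →L[ℝ] WithLp 2 (H × H)}
  (hU : IsGroupGeneratedByInv (waveInv Q) U)
include hU

/-- Undoing the free evolution turns a wave curve into a `C¹` curve. -/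
theorem IsWaveCurve.hasDerivWithinAt_unwind (hQ : Function.Injective Q) {x y h : ℝ → H} {T : ℝ}
    (hw : IsWaveCurve Q x y h T) :
    ∀ t ∈ Icc 0 T, HasDerivWithinAt (fun τ => U (-τ) (WithLp.toLp 2 (x τ, y τ)))
      (U (-t) (WithLp.toLp 2 (0, h t))) (Icc 0 T) t := by
  refine hasDerivWithinAt_of_map (waveInv_injective hQ)
    (hU.neg.continuousOn_apply (continuousOn_toLp continuousOn_const hw.cont_h)) fun t ht => ?_
  have h1 : HasDerivWithinAt (fun τ => waveInv Q (WithLp.toLp 2 (x τ, y τ)))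
      (WithLp.toLp 2 (x t, y t) + waveInv Q (WithLp.toLp 2 (0, h t))) (Icc 0 T) t := by
    have h2 := ((WithLp.prodContinuousLinearEquiv 2 ℝ H H).symm :
      H × H →L[ℝ] WithLp 2 (H × H)).hasFDerivAt.comp_hasDerivWithinAt t
        ((hw.deriv_y t ht).neg.prodMk (hw.deriv_x t ht))
    refine h2.congr_deriv ?_
    rw [waveInv_apply]
    change WithLp.toLp 2 (-(-x t + Q (h t)), y t) = WithLp.toLp 2 (x t, y t) +
      WithLp.toLp 2 (-Q (h t), Q 0)
    rw [← WithLp.toLp_add]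
    simp [add_comm]
  have h3 := hU.neg.hasDerivWithinAt_apply h1 (ξ := -WithLp.toLp 2 (x t, y t)) (by simp)
  simp_rw [← hU.comm]
  refine h3.congr_deriv ?_
  rw [← map_add]
  congr 1
  abel

/-- The converse of `IsWaveCurve.hasDerivWithinAt_unwind`. -/
theorem isWaveCurve_of_hasDerivWithinAt {w : ℝ → WithLp 2 (H × H)} {h : ℝ → H} {T : ℝ}
    (hh : ContinuousOn h (Icc 0 T))
    (hw : ∀ t ∈ Icc 0 T, HasDerivWithinAt w (U (-t) (WithLp.toLp 2 (0, h t))) (Icc 0 T) t) :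
    IsWaveCurve Q (fun t => (U t (w t)).fst) (fun t => (U t (w t)).snd) h T := by
  have hc : ContinuousOn (fun t => U t (w t)) (Icc 0 T) :=
    hU.continuousOn_apply fun t ht => (hw t ht).continuousWithinAt
  have h1 : ∀ t ∈ Icc 0 T, HasDerivWithinAt (fun τ => waveInv Q (U τ (w τ)))
      (waveInv Q (WithLp.toLp 2 (0, h t)) + U t (w t)) (Icc 0 T) t := by
    intro t ht
    have h2 := hU.hasDerivWithinAt_apply
      ((waveInv Q).hasFDerivAt.comp_hasDerivWithinAt t (hw t ht)) (ξ := w t) rfl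
    simp_rw [← hU.comm]
    refine h2.congr_deriv ?_
    rw [hU.comm, hU.apply_neg_apply]
  have h2 : ∀ t ∈ Icc 0 T, HasDerivWithinAt
      (fun τ => ((-Q (U τ (w τ)).snd, Q (U τ (w τ)).fst) : H × H))
      (-Q (h t) + (U t (w t)).fst, (U t (w t)).snd) (Icc 0 T) t := by
    intro t ht
    have h3 := ((WithLp.prodContinuousLinearEquiv 2 ℝ H H) :
      WithLp 2 (H × H) →L[ℝ] H × H).hasFDerivAt.comp_hasDerivWithinAt t (h1 t ht)
    refine h3.congr_deriv ?_
    rw [waveInv_apply]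
    change (-Q (h t) + (U t (w t)).fst, Q 0 + (U t (w t)).snd) = _
    simp
  refine ⟨?_, ?_, hh, fun t ht => ?_, fun t ht => ?_⟩
  · exact (WithLp.prod_continuous_ofLp 2 H H).fst.comp_continuousOn hc
  · exact (WithLp.prod_continuous_ofLp 2 H H).snd.comp_continuousOn hc
  · exact (hasFDerivAt_snd (𝕜 := ℝ) (E := H) (F := H)).comp_hasDerivWithinAt t (h2 t ht)
  · have h3 := ((hasFDerivAt_fst (𝕜 := ℝ) (E := H) (F := H)).comp_hasDerivWithinAt t (h2 t ht)).neg
    have h4 := h3.congr_deriv (g' := -(U t (w t)).fst + Q (h t)) (by simp [add_comm])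
    exact h4.congr (fun s _ => (neg_neg _).symm) (neg_neg _).symm

/-- The energy identity of the wave group. -/
theorem IsWaveCurve.hasDerivWithinAt_sq_norm (hQ : Function.Injective Q) {x y h : ℝ → H} {T : ℝ}
    (hw : IsWaveCurve Q x y h T) : ∀ t ∈ Icc 0 T,
      HasDerivWithinAt (fun τ => ‖x τ‖ ^ 2 + ‖y τ‖ ^ 2) (2 * ⟪y t, h t⟫) (Icc 0 T) t := by
  intro t ht
  have h1 := (hw.hasDerivWithinAt_unwind hU hQ t ht).norm_sq
  rw [hU.inner_map, WithLp.prod_inner_apply] at h1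
  simp only [hU.norm_map, WithLp.prod_norm_sq_eq_of_L2] at h1
  simpa using h1

end

end Wave

/-! ### Differentiating quadratic quantities along wave curves -/

section Calculus

variable {H : Type*} [NormedAddCommGroup H] [InnerProductSpace ℝ H] [CompleteSpace H]

/-- If `a` and `b` are merely continuous but `P a` and `P b` are differentiable, with `P` symmetric,
then `⟪P a, b⟫` is differentiable. -/
theorem hasDerivWithinAt_inner_of_symm {P : H →L[ℝ] H} (hP : ∀ x y, ⟪P x, y⟫ = ⟪x, P y⟫)
    {a b : ℝ → H} {a' b' : H} {s : Set ℝ} {t : ℝ} (hb : ContinuousWithinAt b s t)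
    (ha' : HasDerivWithinAt (fun τ => P (a τ)) a' s t)
    (hb' : HasDerivWithinAt (fun τ => P (b τ)) b' s t) :
    HasDerivWithinAt (fun τ => ⟪P (a τ), b τ⟫) (⟪a', b t⟫ + ⟪a t, b'⟫) s t := by
  rw [hasDerivWithinAt_iff_tendsto_slope] at *
  have h1 : slope (fun τ => ⟪P (a τ), b τ⟫) t = fun τ =>
      ⟪slope (fun τ => P (a τ)) t τ, b τ⟫ + ⟪a t, slope (fun τ => P (b τ)) t τ⟫ := by
    funext τ
    simp only [slope_def_module, real_inner_smul_left, real_inner_smul_right, inner_sub_left,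
      inner_sub_right, smul_eq_mul]
    rw [hP (a t) (b τ), ← hP (a t) (b t)]
    ring
  rw [h1]
  exact (ha'.inner (hb.mono_left (nhdsWithin_mono t sdiff_subset))).add
    (tendsto_const_nhds.inner hb')

/-- The linear energy `½ (|u'|² + |B u|²)`, in terms of `x = (1 + B) u` and `y = u'`. -/
def linEnergy (Q : H →L[ℝ] H) (x y : H) : ℝ := (‖y‖ ^ 2 + ‖x - Q x‖ ^ 2) / 2

variable {B : H →ₗ.[ℝ] H} {Q : H →L[ℝ] H} (hQ : IsResolvent B Q)
include hQ

theorem IsWaveCurve.hasDerivWithinAt_linEnergy {x y h : ℝ → H} {T : ℝ}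
    (hw : IsWaveCurve Q x y h T) : ∀ t ∈ Icc 0 T,
      HasDerivWithinAt (fun τ => linEnergy Q (x τ) (y τ))
        ⟪y t, h t - (2 : ℝ) • x t + Q (x t)⟫ (Icc 0 T) t := by
  intro t ht
  obtain ⟨U, hU⟩ := exists_isGroupGeneratedByInv (waveInv_skew hQ.inner_comm)
    (waveInv_injective hQ.injective)
  have h1 := hw.hasDerivWithinAt_sq_norm hU hQ.injective t ht
  have h2 := hasDerivWithinAt_inner_of_symm hQ.inner_comm (hw.cont_x t ht) (hw.deriv_x t ht)
    (hw.deriv_x t ht)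
  have h3 := (hw.deriv_x t ht).norm_sq
  have h4 : (fun τ => linEnergy Q (x τ) (y τ)) = fun τ =>
      (‖x τ‖ ^ 2 + ‖y τ‖ ^ 2) * (1 / 2) - ⟪Q (x τ), x τ⟫ + ‖Q (x τ)‖ ^ 2 * (1 / 2) := by
    funext τ
    rw [linEnergy, norm_sub_sq_real, real_inner_comm]
    ring
  rw [h4]
  refine (((h1.mul_const _).sub h2).add (h3.mul_const _)).congr_deriv ?_
  rw [inner_add_right, inner_sub_right, real_inner_smul_right, real_inner_comm (y t) (x t),
    real_inner_comm (y t) (Q (x t))]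
  ring

/-- The derivative of `⟪u', B (1 + B)⁻¹ u⟫`, a bounded substitute for the product of `u'` with the
component of `u` orthogonal to `ker B`. -/
theorem IsWaveCurve.hasDerivWithinAt_cross {x y h : ℝ → H} {T : ℝ}
    (hw : IsWaveCurve Q x y h T) : ∀ t ∈ Icc 0 T,
      HasDerivWithinAt (fun τ => ⟪y τ, Q (x τ - Q (x τ))⟫)
        (⟪y t, y t - Q (y t)⟫ - ⟪x t, x t - Q (x t)⟫ + ⟪h t, Q (x t - Q (x t))⟫) (Icc 0 T) t := by
  intro t ht
  have hsym : ∀ x y, ⟪(Q - Q * Q) x, y⟫ = ⟪x, (Q - Q * Q) y⟫ := by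
    intro x y
    change ⟪Q x - Q (Q x), y⟫ = ⟪x, Q y - Q (Q y)⟫
    rw [inner_sub_left, inner_sub_right, hQ.inner_comm (Q x), hQ.inner_comm x, hQ.inner_comm x]
  have hder : ∀ {a : ℝ → H} {a' : H}, HasDerivWithinAt (fun τ => Q (a τ)) a' (Icc 0 T) t →
      HasDerivWithinAt (fun τ => (Q - Q * Q) (a τ)) (a' - Q a') (Icc 0 T) t :=
    fun ha => ha.sub (Q.hasFDerivAt.comp_hasDerivWithinAt t ha)
  have h1 := hasDerivWithinAt_inner_of_symm hsym (hw.cont_x t ht) (hder (hw.deriv_y t ht))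
    (hder (hw.deriv_x t ht))
  have h2 : (fun τ => ⟪y τ, Q (x τ - Q (x τ))⟫) = fun τ => ⟪(Q - Q * Q) (y τ), x τ⟫ := by
    funext τ
    rw [hsym, map_sub]; rfl
  rw [h2]
  refine h1.congr_deriv ?_
  simp only [map_sub, map_add, map_neg, inner_sub_left, inner_sub_right, inner_add_left,
    inner_neg_left, hQ.inner_comm]
  ring

end Calculus

/-! ### The semilinear problem -/

section Semilinear

variable {H : Type*} [NormedAddCommGroup H] [InnerProductSpace ℝ H] [CompleteSpace H]

/-- The right-hand side `h` for which `x' = (1 + B) y`, `y' = -(1 + B) x + h` becomes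
`u'' = -B² u - u' - g`, where `x = (1 + B) u` and `y = u'`. -/
def waveForce (Q : H →L[ℝ] H) (g : H → H) (x y : H) : H := (2 : ℝ) • x - Q x - y - g x

/-- Solutions on `[0, T]` of the semilinear damped wave equation, in the variables `x = (1 + B) u`
and `y = u'`. -/
def IsWaveSolution (Q : H →L[ℝ] H) (g : H → H) (x y : ℝ → H) (T : ℝ) : Prop :=
  IsWaveCurve Q x y (fun t => waveForce Q g (x t) (y t)) T

/-- `f` is a potential of `g` with respect to `u = Q x`: the increment of `f` is linear in `Q v` up
to `o(|Q v|)`, although `v` tends to zero in the norm of `x`, which is stronger than that of `u`. -/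
def IsPotential (Q : H →L[ℝ] H) (f : H → ℝ) (g : H → H) : Prop :=
  ∀ x, (fun v => f (x + v) - f x - ⟪g x, Q v⟫) =o[𝓝 0] fun v => Q v

theorem IsPotential.continuous {Q : H →L[ℝ] H} {f : H → ℝ} {g : H → H} (h : IsPotential Q f g) :
    Continuous f := by
  rw [continuous_iff_continuousAt]
  intro x
  have h1 : Tendsto (fun v => Q v) (𝓝 (0 : H)) (𝓝 0) := by simpa using Q.continuous.tendsto 0
  have h2 : Tendsto (fun v => f (x + v) - f x - ⟪g x, Q v⟫) (𝓝 0) (𝓝 0) := (h x).trans_tendsto h1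
  have h3 : Tendsto (fun v => ⟪g x, Q v⟫) (𝓝 (0 : H)) (𝓝 0) := by
    simpa using tendsto_const_nhds (x := g x).inner h1
  have h4 : Tendsto (fun v => f (x + v)) (𝓝 0) (𝓝 (f x)) := by
    have h5 := (h2.add h3).add_const (f x)
    simpa using h5
  have h6 : Tendsto (fun z => z - x) (𝓝 x) (𝓝 0) := by
    simpa using (continuous_sub_right x).tendsto x
  have h7 := h4.comp h6
  simpa [Function.comp_def, ContinuousAt] using h7

/-- The error in the definition of a potential is measured by `|Q v|`, so differentiability of
`u = Q x` together with mere continuity of `x` suffices for the chain rule. -/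
theorem IsPotential.hasDerivWithinAt {Q : H →L[ℝ] H} {f : H → ℝ} {g : H → H}
    (h : IsPotential Q f g) {x : ℝ → H} {y : H} {s : Set ℝ} {t : ℝ}
    (hx : ContinuousWithinAt x s t) (hx' : HasDerivWithinAt (fun τ => Q (x τ)) y s t) :
    HasDerivWithinAt (fun τ => f (x τ)) ⟪g (x t), y⟫ s t := by
  have h1 : Tendsto (fun τ => x τ - x t) (𝓝[s] t) (𝓝 0) := by simpa using hx.sub_const (x t)
  have h2 := (h (x t)).comp_tendsto h1
  have h3 : (fun τ => Q (x τ - x t)) =O[𝓝[s] t] fun τ => τ - t := by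
    simp_rw [map_sub]
    exact hx'.hasFDerivWithinAt.isBigO_sub
  have h4 := h2.trans_isBigO h3
  have h5 : HasDerivWithinAt (fun τ => ⟪g (x t), Q (x τ)⟫) ⟪g (x t), y⟫ s t := by
    have := (hasDerivWithinAt_const t s (g (x t))).inner ℝ hx'
    simpa using this
  rw [hasDerivWithinAt_iff_isLittleO] at h5 ⊢
  refine (h4.add h5).congr_left fun τ => ?_
  simp only [Function.comp_apply, add_sub_cancel, map_sub, inner_sub_right]
  abel

/-- Lipschitz continuity on bounded sets. -/
def IsBddLipschitz {X Y : Type*} [NormedAddCommGroup X] [NormedAddCommGroup Y] (g : X → Y) : Prop :=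
  ∀ R : ℝ, ∃ K : NNReal, LipschitzOnWith K g (Metric.closedBall 0 R)

theorem IsBddLipschitz.continuous {X Y : Type*} [NormedAddCommGroup X] [NormedAddCommGroup Y]
    {g : X → Y} (hg : IsBddLipschitz g) : Continuous g := by
  rw [continuous_iff_continuousAt]
  intro x
  obtain ⟨K, hK⟩ := hg (‖x‖ + 1)
  refine hK.continuousOn.continuousAt ?_
  refine Filter.mem_of_superset (Metric.ball_mem_nhds x one_pos) fun z hz => ?_
  rw [mem_closedBall_zero_iff]
  rw [mem_ball_iff_norm] at hz
  linarith [norm_le_norm_add_norm_sub' z x]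

/-- Cutting off by the radial retraction onto a ball makes a map that is Lipschitz on bounded sets
globally Lipschitz and bounded. -/
theorem IsBddLipschitz.exists_truncation {X Y : Type*} [NormedAddCommGroup X] [NormedSpace ℝ X]
    [NormedAddCommGroup Y] {N : X → Y} (hN : IsBddLipschitz N) {R : ℝ} (hR : 0 < R) :
    ∃ (N' : X → Y) (K L : NNReal), LipschitzWith K N' ∧ (∀ z, ‖N' z‖ ≤ L) ∧
      ∀ z, ‖z‖ ≤ R → N' z = N z := by
  let r : X → X := fun z => (R / max R ‖z‖) • z
  have hm : ∀ z : X, 0 < max R ‖z‖ := fun z => hR.trans_le (le_max_left _ _)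
  have hr : ∀ z, ‖r z‖ ≤ R := by
    intro z
    rw [norm_smul, Real.norm_of_nonneg (div_pos hR (hm z)).le, div_mul_eq_mul_div,
      div_le_iff₀ (hm z)]
    exact mul_le_mul_of_nonneg_left (le_max_right _ _) hR.le
  have hr1 : ∀ z, ‖z‖ ≤ R → r z = z := by
    intro z hz
    simp only [r]
    rw [max_eq_left hz, div_self hR.ne', one_smul]
  have hrL : LipschitzWith 2 r := by
    refine LipschitzWith.of_dist_le_mul fun z z' => ?_
    rw [dist_eq_norm, dist_eq_norm]
    have h1 : r z - r z' = (R / max R ‖z‖) • (z - z') +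
        (R / max R ‖z‖ - R / max R ‖z'‖) • z' := by
      simp only [r]; module
    have h2 : R / max R ‖z‖ ≤ 1 := (div_le_one (hm z)).2 (le_max_left _ _)
    have h3 : |R / max R ‖z‖ - R / max R ‖z'‖| * ‖z'‖ ≤ ‖z - z'‖ := by
      have h4 : R / max R ‖z‖ - R / max R ‖z'‖ =
          (R / max R ‖z‖) * ((max R ‖z'‖ - max R ‖z‖) / max R ‖z'‖) := by
        have := (hm z).ne'
        have := (hm z').ne'
        field_simp
      have h5 : |max R ‖z'‖ - max R ‖z‖| ≤ ‖z - z'‖ := by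
        have h6 := abs_max_sub_max_le_abs ‖z'‖ ‖z‖ R
        rw [max_comm, max_comm ‖z‖] at h6
        refine h6.trans ?_
        rw [norm_sub_rev]
        exact abs_norm_sub_norm_le z' z
      rw [h4, abs_mul, abs_of_pos (div_pos hR (hm z)), abs_div, abs_of_pos (hm z')]
      have h7 : |max R ‖z'‖ - max R ‖z‖| / max R ‖z'‖ * ‖z'‖ ≤ |max R ‖z'‖ - max R ‖z‖| := by
        rw [div_mul_eq_mul_div, div_le_iff₀ (hm z')]
        exact mul_le_mul_of_nonneg_left (le_max_right _ _) (abs_nonneg _)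
      rw [mul_assoc]
      refine (mul_le_mul h2 (h7.trans h5) ?_ zero_le_one).trans_eq (one_mul _)
      have := (hm z').le
      positivity
    rw [h1]
    refine (norm_add_le _ _).trans ?_
    rw [norm_smul, norm_smul, Real.norm_of_nonneg (div_pos hR (hm z)).le, Real.norm_eq_abs]
    have h8 := mul_le_mul_of_nonneg_right h2 (norm_nonneg (z - z'))
    push_cast
    linarith
  obtain ⟨K, hK⟩ := hN R
  have hrmem : ∀ z, r z ∈ Metric.closedBall (0 : X) R := fun z => by
    rw [mem_closedBall_zero_iff]; exact hr z
  refine ⟨fun z => N (r z), K * 2, ⟨‖N 0‖ + K * R, by positivity⟩, ?_, fun z => ?_,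
    fun z hz => congrArg N (hr1 z hz)⟩
  · rw [← lipschitzOnWith_univ]
    exact hK.comp hrL.lipschitzOnWith fun z _ => hrmem z
  · have h1 := hK.dist_le_mul _ (hrmem z) 0 (by simpa using hR.le)
    rw [dist_eq_norm, dist_zero_right] at h1
    have h2 := norm_le_norm_add_norm_sub' (N (r z)) (N 0)
    have h3 := mul_le_mul_of_nonneg_left (hr z) K.coe_nonneg
    change ‖N (r z)‖ ≤ ‖N 0‖ + K * R
    linarith

end Semilinear

/-! ### Global existence and uniqueness for the semilinear problem -/

section Existence

variable {H : Type*} [NormedAddCommGroup H] [InnerProductSpace ℝ H] [CompleteSpace H]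

/-- The nonlinearity of the first-order system on `H ⊕ H`. -/
def waveField (Q : H →L[ℝ] H) (g : H → H) (z : WithLp 2 (H × H)) : WithLp 2 (H × H) :=
  WithLp.toLp 2 (0, waveForce Q g z.fst z.snd)

theorem norm_toLp_le (x y : H) : ‖WithLp.toLp 2 (x, y)‖ ≤ ‖x‖ + ‖y‖ := by
  have h1 : WithLp.toLp 2 (x, y) = WithLp.toLp 2 (x, (0 : H)) + WithLp.toLp 2 ((0 : H), y) := by
    rw [← WithLp.toLp_add]; simp
  rw [h1]
  refine (norm_add_le _ _).trans ?_
  rw [WithLp.norm_toLp_fst, WithLp.norm_toLp_snd]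

variable {B : H →ₗ.[ℝ] H} {Q : H →L[ℝ] H} (hQ : IsResolvent B Q)
include hQ

theorem isBddLipschitz_waveField {g : H → H} (hg : IsBddLipschitz g) :
    IsBddLipschitz (waveField Q g) := by
  intro R
  obtain ⟨K, hK⟩ := hg R
  refine ⟨4 + K, LipschitzOnWith.of_dist_le_mul fun z hz z' hz' => ?_⟩
  rw [dist_eq_norm, dist_eq_norm, waveField, waveField, ← WithLp.toLp_sub, Prod.mk_sub_mk, sub_zero,
    WithLp.norm_toLp_snd]
  rw [mem_closedBall_zero_iff] at hz hz'
  have h1 : ‖z.fst - z'.fst‖ ≤ ‖z - z'‖ := WithLp.norm_fst_le H (z - z')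
  have h2 : ‖z.snd - z'.snd‖ ≤ ‖z - z'‖ := WithLp.norm_snd_le H (z - z')
  have h3 := hK.dist_le_mul z.fst
    (by rw [mem_closedBall_zero_iff]; exact (WithLp.norm_fst_le H z).trans hz) z'.fst
    (by rw [mem_closedBall_zero_iff]; exact (WithLp.norm_fst_le H z').trans hz')
  rw [dist_eq_norm, dist_eq_norm] at h3
  have h4 : waveForce Q g z.fst z.snd - waveForce Q g z'.fst z'.snd =
      (2 : ℝ) • (z.fst - z'.fst) - Q (z.fst - z'.fst) - (z.snd - z'.snd) -
        (g z.fst - g z'.fst) := by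
    rw [waveForce, waveForce, map_sub]; module
  rw [h4]
  have h5 := norm_sub_le ((2 : ℝ) • (z.fst - z'.fst) - Q (z.fst - z'.fst) - (z.snd - z'.snd))
    (g z.fst - g z'.fst)
  have h6 := norm_sub_le ((2 : ℝ) • (z.fst - z'.fst) - Q (z.fst - z'.fst)) (z.snd - z'.snd)
  have h7 := norm_sub_le ((2 : ℝ) • (z.fst - z'.fst)) (Q (z.fst - z'.fst))
  have h8 := hQ.norm_apply_le (z.fst - z'.fst)
  rw [norm_smul, Real.norm_of_nonneg zero_le_two] at h7
  have h9 := mul_le_mul_of_nonneg_left h1 K.coe_nonneg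
  push_cast
  linarith

/-- Uniqueness: both solutions, with the free evolution undone, solve the same ordinary differential
equation with a Lipschitz right-hand side. -/
theorem IsWaveSolution.eqOn {g : H → H} (hg : IsBddLipschitz g) {x y x' y' : ℝ → H} {T : ℝ}
    (hw : IsWaveSolution Q g x y T) (hw' : IsWaveSolution Q g x' y' T) (hx : x 0 = x' 0)
    (hy : y 0 = y' 0) : EqOn x x' (Icc 0 T) ∧ EqOn y y' (Icc 0 T) := by
  obtain ⟨U, hU⟩ := exists_isGroupGeneratedByInv (waveInv_skew hQ.inner_comm)
    (waveInv_injective hQ.injective)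
  have hcont : ∀ {x y : ℝ → H}, IsWaveSolution Q g x y T →
      ∃ R, ∀ t ∈ Icc 0 T, ‖WithLp.toLp 2 (x t, y t)‖ ≤ R := fun h =>
    isCompact_Icc.exists_bound_of_continuousOn (continuousOn_toLp h.cont_x h.cont_y)
  obtain ⟨R, hR⟩ := hcont hw
  obtain ⟨R', hR'⟩ := hcont hw'
  obtain ⟨K, hK⟩ := isBddLipschitz_waveField hQ hg (max R R')
  let F : ℝ → WithLp 2 (H × H) → WithLp 2 (H × H) := fun t w => U (-t) (waveField Q g (U t w))
  have hFlip : ∀ t, LipschitzOnWith K (F t) (Metric.closedBall 0 (max R R')) := by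
    intro t
    refine LipschitzOnWith.of_dist_le_mul fun w hw v hv => ?_
    have h1 := hK.dist_le_mul (U t w) (by simpa [hU.norm_map] using hw) (U t v)
      (by simpa [hU.norm_map] using hv)
    rw [dist_eq_norm, dist_eq_norm, ← map_sub, hU.norm_map] at h1
    rwa [dist_eq_norm, dist_eq_norm, ← map_sub, hU.norm_map]
  have hder : ∀ {x y : ℝ → H}, IsWaveSolution Q g x y T → ∀ t ∈ Icc 0 T,
      HasDerivWithinAt (fun τ => U (-τ) (WithLp.toLp 2 (x τ, y τ)))
        (F t (U (-t) (WithLp.toLp 2 (x t, y t)))) (Icc 0 T) t := by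
    intro x y h t ht
    have h1 := IsWaveCurve.hasDerivWithinAt_unwind hU hQ.injective h t ht
    simp only [F, hU.apply_neg_apply]
    exact h1
  have hder' : ∀ {x y : ℝ → H}, IsWaveSolution Q g x y T → ∀ t ∈ Ico 0 T,
      HasDerivWithinAt (fun τ => U (-τ) (WithLp.toLp 2 (x τ, y τ)))
        (F t (U (-t) (WithLp.toLp 2 (x t, y t)))) (Ici t) t := by
    intro x y h t ht
    exact (hder h t (Ico_subset_Icc_self ht)).mono_of_mem_nhdsWithin
      (Icc_mem_nhdsGE_of_mem ht)
  have huniq := ODE_solution_unique_of_mem_Icc_right (K := K)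
    (s := fun _ => Metric.closedBall 0 (max R R')) (fun t _ => hFlip t)
    (fun t ht => (hder hw t ht).continuousWithinAt) (hder' hw)
    (fun t ht => by
      rw [mem_closedBall_zero_iff, hU.norm_map]
      exact (hR t (Ico_subset_Icc_self ht)).trans (le_max_left _ _))
    (fun t ht => (hder hw' t ht).continuousWithinAt) (hder' hw')
    (fun t ht => by
      rw [mem_closedBall_zero_iff, hU.norm_map]
      exact (hR' t (Ico_subset_Icc_self ht)).trans (le_max_right _ _))
    (by simp only [hx, hy])
  have h1 : ∀ t ∈ Icc 0 T, WithLp.toLp 2 (x t, y t) = WithLp.toLp 2 (x' t, y' t) := by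
    intro t ht
    have h2 := congrArg (U t) (huniq ht)
    simpa only [hU.apply_neg_apply] using h2
  exact ⟨fun t ht => congrArg (fun z : WithLp 2 (H × H) => z.fst) (h1 t ht),
    fun t ht => congrArg (fun z : WithLp 2 (H × H) => z.snd) (h1 t ht)⟩

section Energy

variable {f : H → ℝ} {g : H → H} (hf : IsPotential Q f g)
include hf

/-- The energy identity of the damped semilinear equation. -/
theorem IsWaveSolution.hasDerivWithinAt_energy {x y : ℝ → H} {T : ℝ}
    (hw : IsWaveSolution Q g x y T) : ∀ t ∈ Icc 0 T,
      HasDerivWithinAt (fun τ => linEnergy Q (x τ) (y τ) + f (x τ)) (-‖y t‖ ^ 2) (Icc 0 T) t := by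
  intro t ht
  have h1 := IsWaveCurve.hasDerivWithinAt_linEnergy hQ hw t ht
  have h2 := hf.hasDerivWithinAt (hw.cont_x t ht) (hw.deriv_x t ht)
  refine (h1.add h2).congr_deriv ?_
  have h3 : waveForce Q g (x t) (y t) - (2 : ℝ) • x t + Q (x t) = -y t - g (x t) := by
    rw [waveForce]; abel
  rw [h3, inner_sub_right, inner_neg_right, real_inner_self_eq_norm_sq, real_inner_comm]
  ring

theorem IsWaveSolution.energy_le {x y : ℝ → H} {T : ℝ} (hw : IsWaveSolution Q g x y T) :
    ∀ t ∈ Icc 0 T, linEnergy Q (x t) (y t) + f (x t) ≤ linEnergy Q (x 0) (y 0) + f (x 0) := by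
  have hder := hw.hasDerivWithinAt_energy hQ hf
  refine image_le_of_deriv_right_le_deriv_boundary
    (fun t ht => (hder t ht).continuousWithinAt)
    (fun t ht => (hder t (Ico_subset_Icc_self ht)).mono_of_mem_nhdsWithin
      (Icc_mem_nhdsGE_of_mem ht)) le_rfl continuousOn_const
    (fun t _ => hasDerivWithinAt_const _ _ _) (fun t _ => ?_)
  have := sq_nonneg ‖y t‖
  linarith

theorem IsWaveSolution.linEnergy_le (hf0 : ∀ x, 0 ≤ f x) {x y : ℝ → H} {T : ℝ}
    (hw : IsWaveSolution Q g x y T) :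
    ∀ t ∈ Icc 0 T, linEnergy Q (x t) (y t) ≤ linEnergy Q (x 0) (y 0) + f (x 0) := fun t ht => by
  have := hw.energy_le hQ hf t ht
  linarith [hf0 (x t)]

/-- Since the velocity is bounded by the energy, solutions grow at most linearly in time. -/
theorem IsWaveSolution.norm_le (hf0 : ∀ x, 0 ≤ f x) {x y : ℝ → H} {T : ℝ}
    (hw : IsWaveSolution Q g x y T) (hT : 0 ≤ T) :
    ‖WithLp.toLp 2 (x T, y T)‖ ≤
      ‖x 0‖ + (T + 2) * √(2 * (linEnergy Q (x 0) (y 0) + f (x 0))) := by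
  set E := √(2 * (linEnergy Q (x 0) (y 0) + f (x 0))) with hE
  have hen : ∀ t ∈ Icc 0 T, ‖y t‖ ≤ E ∧ ‖x t - Q (x t)‖ ≤ E := by
    intro t ht
    have h1 := hw.linEnergy_le hQ hf hf0 t ht
    rw [linEnergy] at h1
    constructor
    · refine Real.le_sqrt_of_sq_le ?_
      have := sq_nonneg ‖x t - Q (x t)‖
      linarith
    · refine Real.le_sqrt_of_sq_le ?_
      have := sq_nonneg ‖y t‖
      linarith
  have hTm : T ∈ Icc 0 T := right_mem_Icc.2 hT
  have h2 := Convex.norm_image_sub_le_of_norm_hasDerivWithin_le hw.deriv_x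
    (fun t ht => (hen t ht).1) (convex_Icc 0 T) (left_mem_Icc.2 hT) hTm
  rw [sub_zero, Real.norm_of_nonneg hT] at h2
  have h3 := norm_toLp_le (x T) (y T)
  have h4 := norm_le_norm_add_norm_sub' (Q (x T)) (Q (x 0))
  have h5 := norm_le_norm_add_norm_sub' (x T) (Q (x T))
  have h6 := hQ.norm_apply_le (x 0)
  obtain ⟨h7, h8⟩ := hen T hTm
  linarith

/-- On `[0, T]` the problem with the nonlinearity cut off far from the origin has a solution by the
Picard–Lindelöf theorem, and the energy bound keeps this solution away from the cut-off. -/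
theorem exists_isWaveSolution (hg : IsBddLipschitz g) (hf0 : ∀ x, 0 ≤ f x) (x₀ y₀ : H) {T : ℝ}
    (hT : 0 ≤ T) : ∃ x y : ℝ → H, IsWaveSolution Q g x y T ∧ x 0 = x₀ ∧ y 0 = y₀ := by
  obtain ⟨U, hU⟩ := exists_isGroupGeneratedByInv (waveInv_skew hQ.inner_comm)
    (waveInv_injective hQ.injective)
  set E := √(2 * (linEnergy Q x₀ y₀ + f x₀)) with hE
  set R := ‖x₀‖ + (T + 2) * E + 1 with hR
  have hRpos : 0 < R := by positivity
  obtain ⟨N, K, L, hNlip, hNle, hN⟩ :=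
    ((isBddLipschitz_waveField hQ hg).exists_truncation hRpos)
  -- the first component of the truncated field is discarded
  let P : WithLp 2 (H × H) → WithLp 2 (H × H) := fun z => WithLp.toLp 2 (0, (N z).snd)
  have hPlip : ∀ z z', ‖P z - P z'‖ ≤ K * ‖z - z'‖ := by
    intro z z'
    have h1 : P z - P z' = WithLp.toLp 2 (0, (N z - N z').snd) := by
      simp only [P]
      rw [← WithLp.toLp_sub, Prod.mk_sub_mk, sub_zero, WithLp.sub_snd]
    rw [h1, WithLp.norm_toLp_snd]
    refine (WithLp.norm_snd_le H _).trans ?_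
    rw [← dist_eq_norm, ← dist_eq_norm]
    exact hNlip.dist_le_mul z z'
  have hPle : ∀ z, ‖P z‖ ≤ L := fun z => by
    rw [WithLp.norm_toLp_snd]
    exact (WithLp.norm_snd_le H _).trans (hNle z)
  have hPc : Continuous P := by
    refine (LipschitzWith.of_dist_le_mul (K := K) fun z z' => ?_).continuous
    rw [dist_eq_norm, dist_eq_norm]
    exact hPlip z z'
  have hpl : IsPicardLindelof (fun t w => U (-t) (P (U t w)))
      (⟨0, left_mem_Icc.2 hT⟩ : Icc (0 : ℝ) T) (U (-0) (WithLp.toLp 2 (x₀, y₀)))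
      (L * ⟨T, hT⟩) 0 L K := by
    refine ⟨fun t _ => LipschitzOnWith.of_dist_le_mul fun w _ v _ => ?_, fun w _ => ?_,
      fun t _ w _ => ?_, ?_⟩
    · rw [dist_eq_norm, dist_eq_norm, ← map_sub, hU.norm_map]
      refine (hPlip _ _).trans_eq ?_
      rw [← map_sub, hU.norm_map]
    · exact hU.neg.continuousOn_apply (hPc.comp (hU.continuous w)).continuousOn
    · rw [hU.norm_map]; exact hPle _
    · change (L : ℝ) * max (T - 0) (0 - 0) ≤ L * T - 0
      simp [hT]
  obtain ⟨w, hw0, hw⟩ := hpl.exists_eq_forall_mem_Icc_hasDerivWithinAt₀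
  have hwc : ContinuousOn (fun t => U t (w t)) (Icc 0 T) :=
    hU.continuousOn_apply fun t ht => (hw t ht).continuousWithinAt
  have hhc : ContinuousOn (fun t => (N (U t (w t))).snd) (Icc 0 T) :=
    (WithLp.prod_continuous_ofLp 2 H H).snd.comp_continuousOn
      (hNlip.continuous.comp_continuousOn hwc)
  have hcurve := isWaveCurve_of_hasDerivWithinAt hU hhc hw
  have hU0 : U 0 (w 0) = WithLp.toLp 2 (x₀, y₀) := by
    have h1 : w 0 = U (-0) (WithLp.toLp 2 (x₀, y₀)) := hw0
    rw [h1, hU.apply_neg_apply]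
  have hx0 : (U 0 (w 0)).fst = x₀ := by rw [hU0]; rfl
  have hy0 : (U 0 (w 0)).snd = y₀ := by rw [hU0]; rfl
  have hsol : ∀ τ ≤ T, (∀ s ∈ Icc 0 τ, ‖U s (w s)‖ ≤ R) →
      IsWaveSolution Q g (fun t => (U t (w t)).fst) (fun t => (U t (w t)).snd) τ := by
    intro τ hτ hle
    refine (hcurve.mono hτ).congr (fun _ _ => rfl) (fun _ _ => rfl) fun s hs => ?_
    change _ = (N (U s (w s))).snd
    rw [hN _ (hle s hs)]
    rfl
  have hnc : ContinuousOn (fun t => ‖U t (w t)‖) (Icc 0 T) := hwc.norm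
  have hE0 : 0 ≤ E := Real.sqrt_nonneg _
  have hstart : ‖U 0 (w 0)‖ ≤ R := by
    rw [hU0]
    have h1 : ‖y₀‖ ≤ E := by
      refine Real.le_sqrt_of_sq_le ?_
      rw [linEnergy]
      have := sq_nonneg ‖x₀ - Q x₀‖
      linarith [hf0 x₀]
    have h2 := norm_toLp_le x₀ y₀
    have h3 := mul_nonneg hT hE0
    rw [hR]
    linarith
  have hbound : ∀ t ∈ Icc 0 T, ‖U t (w t)‖ ≤ R := by
    by_contra! hcon
    obtain ⟨t₁, ht₁, hlt⟩ := hcon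
    -- every time at which the norm exceeds `R` is preceded by one at which it equals `R`
    have hivt : ∀ s ∈ Icc 0 T, R ≤ ‖U s (w s)‖ → ∃ r ∈ Icc 0 s, ‖U r (w r)‖ = R := by
      intro s hs hle
      exact intermediate_value_Icc hs.1 (hnc.mono (Icc_subset_Icc_right hs.2)) ⟨hstart, hle⟩
    let C : Set ℝ := Icc 0 T ∩ (fun t => ‖U t (w t)‖) ⁻¹' {R}
    have hC : IsCompact C :=
      isCompact_Icc.of_isClosed_subset (hnc.preimage_isClosed_of_isClosed isClosed_Icc
        isClosed_singleton) inter_subset_left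
    obtain ⟨r, hr, hrR⟩ := hivt t₁ ht₁ hlt.le
    obtain ⟨τ, ⟨hτ, hτR⟩, hmin⟩ := hC.exists_isLeast ⟨r, ⟨hr.1, hr.2.trans ht₁.2⟩, hrR⟩
    have hτR' : ‖U τ (w τ)‖ = R := hτR
    have hle : ∀ s ∈ Icc 0 τ, ‖U s (w s)‖ ≤ R := by
      intro s hs
      by_contra! hs'
      obtain ⟨q, hq, hqR⟩ := hivt s ⟨hs.1, hs.2.trans hτ.2⟩ hs'.le
      have h1 : τ ≤ q := hmin ⟨⟨hq.1, hq.2.trans (hs.2.trans hτ.2)⟩, hqR⟩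
      have h2 : s = τ := le_antisymm hs.2 (h1.trans hq.2)
      rw [h2, hτR'] at hs'
      exact lt_irrefl _ hs'
    have h1 := (hsol τ hτ.2 hle).norm_le hQ hf hf0 hτ.1
    simp only [hx0, hy0] at h1
    rw [← hE] at h1
    have h2 : ‖U τ (w τ)‖ ≤ ‖x₀‖ + (τ + 2) * E := h1
    have h3 : (τ + 2) * E ≤ (T + 2) * E := by gcongr; exact hτ.2
    rw [hτR', hR] at h2
    linarith
  exact ⟨_, _, hsol T le_rfl hbound, hx0, hy0⟩

/-- Global solutions, glued from the solutions on `[0, n]`. -/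
theorem exists_forall_isWaveSolution (hg : IsBddLipschitz g) (hf0 : ∀ x, 0 ≤ f x) (x₀ y₀ : H) :
    ∃ x y : ℝ → H, (∀ T, IsWaveSolution Q g x y T) ∧ x 0 = x₀ ∧ y 0 = y₀ := by
  choose X Y hXY hX0 hY0 using fun n : ℕ =>
    exists_isWaveSolution hQ hf hg hf0 x₀ y₀ (Nat.cast_nonneg (α := ℝ) n)
  have hagree : ∀ (n m : ℕ) (t : ℝ), 0 ≤ t → t ≤ n → t ≤ m → X n t = X m t ∧ Y n t = Y m t := by
    intro n m t h0 hn hm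
    have h1 := IsWaveSolution.eqOn hQ hg ((hXY n).mono hn) ((hXY m).mono hm)
      (by rw [hX0, hX0]) (by rw [hY0, hY0])
    exact ⟨h1.1 (right_mem_Icc.2 h0), h1.2 (right_mem_Icc.2 h0)⟩
  refine ⟨fun t => X ⌈t⌉₊ t, fun t => Y ⌈t⌉₊ t, fun T => ?_, ?_, ?_⟩
  · have hag : ∀ t ∈ Icc 0 T, X ⌈t⌉₊ t = X ⌈T⌉₊ t ∧ Y ⌈t⌉₊ t = Y ⌈T⌉₊ t := fun t ht =>
      hagree _ _ t ht.1 (Nat.le_ceil t) (ht.2.trans (Nat.le_ceil T))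
    refine ((hXY ⌈T⌉₊).mono (Nat.le_ceil T)).congr (fun t ht => (hag t ht).1)
      (fun t ht => (hag t ht).2) fun t ht => ?_
    simp only [(hag t ht).1, (hag t ht).2]
  · simp [hX0]
  · simp [hY0]

end Energy

end Existence

/-! ### The lower bound for slow solutions -/

section SlowDecay

theorem sq_rpow {r : ℝ} (hr : 0 ≤ r) (c : ℝ) : (r ^ 2) ^ c = r ^ (2 * c) := by
  rw [← Real.rpow_natCast, ← Real.rpow_mul hr]
  norm_num

theorem dissipation_le {κ a d G : ℝ} (hκ : 0 < κ) (hκ1 : κ ≤ 1) :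
    -a ^ 2 + a * G + κ / 8 * (a ^ 2 - κ * d ^ 2 + a * d + G * d) ≤
      -(κ ^ 2 / 16) * (a ^ 2 + d ^ 2) + 2 * G ^ 2 := by
  have h1 : κ * (a * d) ≤ κ ^ 2 / 4 * d ^ 2 + a ^ 2 := by nlinarith [sq_nonneg (κ * d / 2 - a)]
  have h2 : κ * (G * d) ≤ κ ^ 2 / 4 * d ^ 2 + G ^ 2 := by nlinarith [sq_nonneg (κ * d / 2 - G)]
  have h3 : a * G ≤ a ^ 2 / 4 + G ^ 2 := by nlinarith [sq_nonneg (a / 2 - G)]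
  have h4 : κ * a ^ 2 ≤ a ^ 2 := by nlinarith [sq_nonneg a]
  have h5 : κ ^ 2 * a ^ 2 ≤ a ^ 2 := by nlinarith [sq_nonneg a]
  nlinarith [sq_nonneg a, sq_nonneg G]

/-- The numerical inequality behind the barrier: here `a = |u'|`, `d = |B u|`, `G = |∇F(u)|`,
`r = |u|`, and the perturbed energy `Ψ` equals `M r ^ (2p+2)`. -/
theorem barrier_inequality {c R M δ p α η a d G r Ψ D I : ℝ} (hp : 0 < p) (hα : 0 < α)
    (hR : 0 < R) (hM : M = 16 * R ^ 2 / c + 1) (hc : 0 < c)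
    (hδ : 4 * (p + 1) * √M * δ ^ p ≤ c / 4) (hη : 4 * R ^ 2 * (2 * η) ^ α ≤ c / 2)
    (hd : 0 ≤ d) (hG : 0 ≤ G) (hr : 0 < r) (hrδ : r ≤ δ) (hdη : d ^ 2 ≤ 2 * η)
    (hGle : G ≤ R * (r ^ (p + 1) + d ^ (1 + α)))
    (hΨ : (a ^ 2 + d ^ 2) / 4 ≤ Ψ) (hΨ' : Ψ ≤ a ^ 2 + d ^ 2) (hΨM : Ψ = M * (r ^ 2) ^ (p + 1))
    (hD : D ≤ -c * (a ^ 2 + d ^ 2) + 2 * G ^ 2) (hI : |I| ≤ r * a) :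
    D < M * ((p + 1) * (r ^ 2) ^ p * (2 * I)) := by
  set s := r ^ (p + 1) with hs
  have hs0 : 0 < s := Real.rpow_pos_of_pos hr _
  have hMpos : 0 < M := by rw [hM]; positivity
  have hs2 : (r ^ 2) ^ (p + 1) = s ^ 2 := by
    rw [sq_rpow hr.le, hs, ← Real.rpow_natCast, ← Real.rpow_mul hr.le]
    congr 1; push_cast; ring
  have hrp : (r ^ 2) ^ p * r = r ^ p * s := by
    rw [sq_rpow hr.le, hs, ← Real.rpow_add_one hr.ne', ← Real.rpow_add hr]
    congr 1; ring
  rw [hs2] at hΨM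
  -- the gradient
  have hdα : (d ^ (1 + α)) ^ 2 ≤ d ^ 2 * (2 * η) ^ α := by
    have h1 : (d ^ (1 + α)) ^ 2 = d ^ 2 * (d ^ 2) ^ α := by
      rw [sq_rpow hd, ← Real.rpow_natCast, ← Real.rpow_mul hd, ← Real.rpow_natCast,
        ← Real.rpow_add_of_nonneg hd (by norm_num) (by positivity)]
      congr 1; push_cast; ring
    rw [h1]
    exact mul_le_mul_of_nonneg_left (Real.rpow_le_rpow (sq_nonneg _) hdη hα.le) (sq_nonneg _)
  have hG2 : 2 * G ^ 2 ≤ 4 * R ^ 2 * s ^ 2 + c / 2 * d ^ 2 := by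
    have h1 : G ^ 2 ≤ (R * (s + d ^ (1 + α))) ^ 2 := pow_le_pow_left₀ hG hGle 2
    have h2 : (R * (s + d ^ (1 + α))) ^ 2 ≤ 2 * R ^ 2 * (s ^ 2 + (d ^ (1 + α)) ^ 2) := by
      nlinarith [mul_nonneg (sq_nonneg R) (sq_nonneg (s - d ^ (1 + α)))]
    have h3 := mul_le_mul_of_nonneg_left hdα (show 0 ≤ 4 * R ^ 2 by positivity)
    have h4 := mul_le_mul_of_nonneg_right hη (sq_nonneg d)
    linarith
  have hD2 : D ≤ (-(c / 2) * M + 4 * R ^ 2) * s ^ 2 := by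
    have h1 : c / 2 * Ψ ≤ c / 2 * (a ^ 2 + d ^ 2) := by gcongr
    rw [hΨM] at h1
    nlinarith [mul_nonneg hc.le (sq_nonneg a)]
  -- the velocity
  have ha2 : a ≤ 2 * √M * s := by
    refine le_of_sq_le_sq ?_ (by positivity)
    rw [mul_pow, mul_pow, Real.sq_sqrt hMpos.le]
    nlinarith [sq_nonneg d]
  have hI2 : -(r * (2 * √M * s)) ≤ I := by
    have h1 := (abs_le.1 hI).1
    have h2 := mul_le_mul_of_nonneg_left ha2 hr.le
    linarith
  have hB : -(c / 4 * M) * s ^ 2 ≤ M * ((p + 1) * (r ^ 2) ^ p * (2 * I)) := by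
    have h1 : M * ((p + 1) * (r ^ 2) ^ p * (2 * -(r * (2 * √M * s)))) ≤
        M * ((p + 1) * (r ^ 2) ^ p * (2 * I)) := by gcongr
    refine le_trans ?_ h1
    have h2 : M * ((p + 1) * (r ^ 2) ^ p * (2 * -(r * (2 * √M * s)))) =
        -(M * s ^ 2) * (4 * (p + 1) * √M * r ^ p) := by
      linear_combination -(4 * M * (p + 1) * √M * s) * hrp
    have h3 : 4 * (p + 1) * √M * r ^ p ≤ c / 4 := by
      refine le_trans ?_ hδ
      have := Real.rpow_le_rpow hr.le hrδ hp.le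
      gcongr
    rw [h2]
    have h4 := mul_le_mul_of_nonneg_left h3 (show 0 ≤ M * s ^ 2 by positivity)
    linarith
  have hfin : -(c / 2) * M + 4 * R ^ 2 < -(c / 4 * M) := by
    have h1 : c * M = 16 * R ^ 2 + c := by rw [hM]; field_simp
    linarith
  have := mul_lt_mul_of_pos_right hfin (show 0 < s ^ 2 by positivity)
  linarith

variable {H : Type*} [NormedAddCommGroup H] [InnerProductSpace ℝ H] [CompleteSpace H]

/-- The perturbed linear energy `½ (|u'|² + |B u|²) + β ⟪u', B (1 + B)⁻¹ u⟫`. The cross term makes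
it dissipate `|B u|²` as well as `|u'|²`. -/
def perturbedEnergy (Q : H →L[ℝ] H) (β : ℝ) (x y : H) : ℝ :=
  linEnergy Q x y + β * ⟪y, Q (x - Q x)⟫

variable {B : H →ₗ.[ℝ] H} {Q : H →L[ℝ] H} (hQ : IsResolvent B Q)
include hQ

theorem perturbedEnergy_bounds {β : ℝ} (hβ : 0 ≤ β) (hβ' : β ≤ 1 / 8) (x y : H) :
    (‖y‖ ^ 2 + ‖x - Q x‖ ^ 2) / 4 ≤ perturbedEnergy Q β x y ∧
      perturbedEnergy Q β x y ≤ ‖y‖ ^ 2 + ‖x - Q x‖ ^ 2 := by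
  have h1 := abs_real_inner_le_norm y (Q (x - Q x))
  have h2 := mul_le_mul_of_nonneg_left (hQ.norm_apply_le (x - Q x)) (norm_nonneg y)
  have h3 := abs_le.1 (h1.trans h2)
  have h4 := two_mul_le_add_sq ‖y‖ ‖x - Q x‖
  have h5 : |β * ⟪y, Q (x - Q x)⟫| ≤ (1 / 8) * (‖y‖ * ‖x - Q x‖) := by
    rw [abs_mul, abs_of_nonneg hβ]
    exact mul_le_mul hβ' (h1.trans h2) (abs_nonneg _) (by norm_num)
  have h6 := abs_le.1 h5
  rw [perturbedEnergy, linEnergy]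
  constructor <;> nlinarith [sq_nonneg ‖y‖, sq_nonneg ‖x - Q x‖]

/-- Dissipation of the perturbed energy, given the coercivity of `B (1 + B)⁻¹` on the range
of `B`. -/
theorem IsWaveSolution.exists_hasDerivWithinAt_perturbedEnergy {g : H → H} {κ : ℝ} (hκ : 0 < κ)
    (hκ1 : κ ≤ 1)
    (hco : ∀ x, κ * ‖x - Q x‖ ^ 2 ≤ ⟪x - Q x, (x - Q x) - Q (x - Q x)⟫)
    {x y : ℝ → H} {T : ℝ} (hw : IsWaveSolution Q g x y T) {t : ℝ} (ht : t ∈ Icc 0 T) :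
    ∃ D, HasDerivWithinAt (fun τ => perturbedEnergy Q (κ / 8) (x τ) (y τ)) D (Icc 0 T) t ∧
      D ≤ -(κ ^ 2 / 16) * (‖y t‖ ^ 2 + ‖x t - Q (x t)‖ ^ 2) + 2 * ‖g (x t)‖ ^ 2 := by
  refine ⟨_, (IsWaveCurve.hasDerivWithinAt_linEnergy hQ hw t ht).add
    ((IsWaveCurve.hasDerivWithinAt_cross hQ hw t ht).const_mul (κ / 8)), ?_⟩
  generalize x t = x
  generalize y t = y
  refine le_trans ?_ (dissipation_le hκ hκ1)
  set v := x - Q x with hv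
  have h1 : ⟪y, waveForce Q g x y - (2 : ℝ) • x + Q x⟫ = -‖y‖ ^ 2 - ⟪y, g x⟫ := by
    have h3 : waveForce Q g x y - (2 : ℝ) • x + Q x = -y - g x := by rw [waveForce]; abel
    rw [h3, inner_sub_right, inner_neg_right, real_inner_self_eq_norm_sq]
  have h2 : ⟪waveForce Q g x y, Q v⟫ =
      ⟪x, v⟫ - ⟪v, v - Q v⟫ - ⟪y, Q v⟫ - ⟪g x, Q v⟫ := by
    have h4 : ⟪v, v - Q v⟫ = ⟪x, v⟫ - ⟪x, Q v⟫ - ⟪Q x, v⟫ + ⟪Q x, Q v⟫ := by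
      nth_rewrite 1 [hv]
      simp only [inner_sub_left, inner_sub_right]
      ring
    rw [waveForce, inner_sub_left, inner_sub_left, inner_sub_left, real_inner_smul_left, h4,
      hQ.inner_comm x v]
    ring
  have h5 : ⟪y, y - Q y⟫ ≤ ‖y‖ ^ 2 := by
    have h6 := (sq_nonneg ‖Q y‖).trans (hQ.sq_norm_le y)
    rw [inner_sub_right, real_inner_self_eq_norm_sq, real_inner_comm]
    linarith
  have h6 := hco x
  have hQv := hQ.norm_apply_le v
  have h7 : -⟪y, Q v⟫ ≤ ‖y‖ * ‖v‖ := by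
    have := (abs_le.1 (abs_real_inner_le_norm y (Q v))).1
    have := mul_le_mul_of_nonneg_left hQv (norm_nonneg y)
    linarith
  have h8 : -⟪g x, Q v⟫ ≤ ‖g x‖ * ‖v‖ := by
    have := (abs_le.1 (abs_real_inner_le_norm (g x) (Q v))).1
    have := mul_le_mul_of_nonneg_left hQv (norm_nonneg (g x))
    linarith
  have h9 : -⟪y, g x⟫ ≤ ‖y‖ * ‖g x‖ := by
    have := (abs_le.1 (abs_real_inner_le_norm y (g x))).1
    linarith
  rw [h1, h2]
  have h10 : ⟪y, y - Q y⟫ - ⟪x, v⟫ + (⟪x, v⟫ - ⟪v, v - Q v⟫ - ⟪y, Q v⟫ - ⟪g x, Q v⟫) ≤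
      ‖y‖ ^ 2 - κ * ‖v‖ ^ 2 + ‖y‖ * ‖v‖ + ‖g x‖ * ‖v‖ := by linarith
  have h11 := mul_le_mul_of_nonneg_left h10 (show 0 ≤ κ / 8 by positivity)
  linarith

end SlowDecay

section SlowSolution

variable {H : Type*} [NormedAddCommGroup H] [InnerProductSpace ℝ H] [CompleteSpace H]
  {B : H →ₗ.[ℝ] H} {Q : H →L[ℝ] H}

theorem hasDerivWithinAt_Ici_of_Icc {F : Type*} [NormedAddCommGroup F] [NormedSpace ℝ F]
    {f : ℝ → F} {f' : F} {T t : ℝ} (ht : t ∈ Ico 0 T) (h : HasDerivWithinAt f f' (Icc 0 T) t) :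
    HasDerivWithinAt f f' (Ici t) t :=
  h.mono_of_mem_nhdsWithin (Icc_mem_nhdsGE_of_mem ht)

/-- The constants of the barrier argument: `c` is the dissipation rate, `M` the bound for the ratio
`(|u'|² + |B u|²) / |u| ^ (2p+2)`, `δ` the radius within which the ratio is controlled through the
differential inequality, and `η` the energy level that controls it outside. -/
structure BarrierConstants (Q : H →L[ℝ] H) (g : H → H) (p c R M δ α η : ℝ) : Prop where
  p_pos : 0 < p
  c_pos : 0 < c
  R_pos : 0 < R
  δ_pos : 0 < δ
  α_pos : 0 < α
  M_eq : M = 16 * R ^ 2 / c + 1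
  δ_small : 4 * (p + 1) * √M * δ ^ p ≤ c / 4
  η_small : 4 * R ^ 2 * (2 * η) ^ α ≤ c / 2
  η_lt : 2 * η < M * (δ ^ 2) ^ (p + 1)
  norm_le : ∀ x, ‖Q x‖ ≤ δ → ‖x - Q x‖ ^ 2 ≤ 2 * η →
    ‖g x‖ ≤ R * (‖Q x‖ ^ (p + 1) + ‖x - Q x‖ ^ (1 + α))

theorem BarrierConstants.M_pos {g : H → H} {p c R M δ α η : ℝ}
    (hb : BarrierConstants Q g p c R M δ α η) : 0 < M := by
  have := hb.c_pos
  rw [hb.M_eq]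
  positivity

section

variable (hQ : IsResolvent B Q) {f : H → ℝ} {g : H → H} (hf : IsPotential Q f g)
  (hf0 : ∀ x, 0 ≤ f x) {κ : ℝ} (hκ : 0 < κ) (hκ1 : κ ≤ 1)
  (hco : ∀ x, κ * ‖x - Q x‖ ^ 2 ≤ ⟪x - Q x, (x - Q x) - Q (x - Q x)⟫)
  {p R M δ α η : ℝ} (hb : BarrierConstants Q g p (κ ^ 2 / 16) R M δ α η)
  {x y : ℝ → H} {T : ℝ} (hw : IsWaveSolution Q g x y T)
  (hen : linEnergy Q (x 0) (y 0) + f (x 0) ≤ η)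
  (hinit : ‖y 0‖ ^ 2 + ‖x 0 - Q (x 0)‖ ^ 2 ≤ M * (‖Q (x 0)‖ ^ 2) ^ (p + 1))
include hQ hf hf0 hκ hκ1 hco hb hw hen hinit

/-- As long as `u` does not vanish, the perturbed energy stays below `M |u| ^ (2p+2)`: if equality
held at some time, then either `|u| ≥ δ`, which the total energy excludes, or `|u| < δ`, and then
the perturbed energy decreases faster than `M |u| ^ (2p+2)`. -/
theorem IsWaveSolution.perturbedEnergy_le (hne : ∀ t ∈ Ico 0 T, Q (x t) ≠ 0) :
    ∀ t ∈ Icc 0 T, perturbedEnergy Q (κ / 8) (x t) (y t) ≤ M * (‖Q (x t)‖ ^ 2) ^ (p + 1) := by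
  have hp := hb.p_pos
  have hMpos := hb.M_pos
  have hκ0 : 0 ≤ κ / 8 := by positivity
  have hκ8 : κ / 8 ≤ 1 / 8 := by linarith
  choose! D hD hDle using fun t (ht : t ∈ Icc 0 T) =>
    IsWaveSolution.exists_hasDerivWithinAt_perturbedEnergy hQ hκ hκ1 hco hw ht
  have hq : ∀ t ∈ Icc 0 T, HasDerivWithinAt (fun τ => M * (‖Q (x τ)‖ ^ 2) ^ (p + 1))
      (M * ((p + 1) * (‖Q (x t)‖ ^ 2) ^ p * (2 * ⟪Q (x t), y t⟫))) (Icc 0 T) t := by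
    intro t ht
    have h1 := ((hw.deriv_x t ht).norm_sq.rpow_const (p := p + 1)
      (Or.inr (by linarith))).const_mul M
    refine h1.congr_deriv ?_
    rw [add_sub_cancel_right]
    ring
  refine image_le_of_deriv_right_lt_deriv_boundary'
    (fun t ht => (hD t ht).continuousWithinAt)
    (fun t ht => hasDerivWithinAt_Ici_of_Icc ht (hD t (Ico_subset_Icc_self ht)))
    ((perturbedEnergy_bounds hQ hκ0 hκ8 _ _).2.trans hinit)
    (fun t ht => (hq t ht).continuousWithinAt)
    (fun t ht => hasDerivWithinAt_Ici_of_Icc ht (hq t (Ico_subset_Icc_self ht)))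
    fun t ht heq => ?_
  have htI := Ico_subset_Icc_self ht
  obtain ⟨hΨ, hΨ'⟩ := perturbedEnergy_bounds hQ hκ0 hκ8 (x t) (y t)
  have hE := (hw.linEnergy_le hQ hf hf0 t htI).trans hen
  rw [linEnergy] at hE
  have hr : 0 < ‖Q (x t)‖ := norm_pos_iff.2 (hne t ht)
  have hrδ : ‖Q (x t)‖ ≤ δ := by
    by_contra! hlt
    have h1 : (δ ^ 2) ^ (p + 1) ≤ (‖Q (x t)‖ ^ 2) ^ (p + 1) :=
      Real.rpow_le_rpow (sq_nonneg _) (pow_le_pow_left₀ hb.δ_pos.le hlt.le 2) (by linarith)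
    have h2 := mul_le_mul_of_nonneg_left h1 hMpos.le
    have h3 := hb.η_lt
    linarith
  have hdη : ‖x t - Q (x t)‖ ^ 2 ≤ 2 * η := by linarith [sq_nonneg ‖y t‖]
  exact barrier_inequality hp hb.α_pos hb.R_pos hb.M_eq hb.c_pos hb.δ_small hb.η_small
    (norm_nonneg _) (norm_nonneg _) hr hrδ hdη (hb.norm_le _ hrδ hdη) hΨ hΨ' heq
    (hDle t htI) (abs_real_inner_le_norm _ _)

/-- The bound on the velocity by `|u| ^ (p+1)` gives a differential inequality for `|u| ^ (-p)`. -/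
theorem IsWaveSolution.norm_rpow_neg_le_of_ne_zero (hne : ∀ t ∈ Icc 0 T, Q (x t) ≠ 0)
    (hT : 0 ≤ T) :
    ‖Q (x T)‖ ^ (-p) ≤ ‖Q (x 0)‖ ^ (-p) + 2 * √M * p * T := by
  have hp := hb.p_pos
  have hMpos := hb.M_pos
  have hΨ := hw.perturbedEnergy_le hQ hf hf0 hκ hκ1 hco hb hen hinit
    fun t ht => hne t (Ico_subset_Icc_self ht)
  have hr : ∀ t ∈ Icc 0 T, 0 < ‖Q (x t)‖ := fun t ht => norm_pos_iff.2 (hne t ht)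
  have hq : ∀ t ∈ Icc 0 T, HasDerivWithinAt (fun τ => (‖Q (x τ)‖ ^ 2) ^ (-p / 2))
      (-p * ⟪Q (x t), y t⟫ * (‖Q (x t)‖ ^ 2) ^ (-p / 2 - 1)) (Icc 0 T) t := by
    intro t ht
    have h1 := (hw.deriv_x t ht).norm_sq.rpow_const (p := -p / 2)
      (Or.inl (pow_pos (hr t ht) 2).ne')
    refine h1.congr_deriv ?_
    ring
  have hlin : ∀ t, HasDerivAt (fun τ => ‖Q (x 0)‖ ^ (-p) + 2 * √M * p * τ) (2 * √M * p) t := by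
    intro t
    simpa using ((hasDerivAt_id t).const_mul (2 * √M * p)).const_add (‖Q (x 0)‖ ^ (-p))
  have hsq : ∀ t, (‖Q (x t)‖ ^ 2) ^ (-p / 2) = ‖Q (x t)‖ ^ (-p) := by
    intro t
    rw [sq_rpow (norm_nonneg _)]
    congr 1
    ring
  have hmain := image_le_of_deriv_right_le_deriv_boundary
    (fun t ht => (hq t ht).continuousWithinAt)
    (fun t ht => hasDerivWithinAt_Ici_of_Icc ht (hq t (Ico_subset_Icc_self ht)))
    (B := fun τ => ‖Q (x 0)‖ ^ (-p) + 2 * √M * p * τ)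
    (by simp only [hsq, mul_zero, add_zero]; exact le_rfl)
    (fun t _ => (hlin t).continuousAt.continuousWithinAt)
    (fun t _ => (hlin t).hasDerivWithinAt) (fun t ht => ?_) (right_mem_Icc.2 hT)
  · simpa only [hsq] using hmain
  · have htI := Ico_subset_Icc_self ht
    have hrt := hr t htI
    set r := ‖Q (x t)‖ with hrdef
    have ha : ‖y t‖ ≤ 2 * √M * r ^ (p + 1) := by
      have h1 := (perturbedEnergy_bounds hQ (show 0 ≤ κ / 8 by positivity) (by linarith)
        (x t) (y t)).1
      have h2 := hΨ t htI
      refine le_of_sq_le_sq ?_ (by positivity)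
      have h3 : (2 * √M * r ^ (p + 1)) ^ 2 = 4 * (M * (r ^ 2) ^ (p + 1)) := by
        rw [mul_pow, mul_pow, Real.sq_sqrt hMpos.le, sq_rpow hrt.le, ← Real.rpow_natCast,
          ← Real.rpow_natCast (r ^ (p + 1)), ← Real.rpow_mul hrt.le,
          show (p + 1) * ((2 : ℕ) : ℝ) = 2 * (p + 1) by push_cast; ring]
        norm_num
        ring
      rw [h3]
      linarith [sq_nonneg ‖x t - Q (x t)‖]
    have hI : -⟪Q (x t), y t⟫ ≤ r * (2 * √M * r ^ (p + 1)) := by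
      have h1 := (abs_le.1 (abs_real_inner_le_norm (Q (x t)) (y t))).1
      have h2 := mul_le_mul_of_nonneg_left ha hrt.le
      linarith
    have hpow : r * r ^ (p + 1) * (r ^ 2) ^ (-p / 2 - 1) = 1 := by
      rw [sq_rpow hrt.le, mul_comm r, ← Real.rpow_add_one hrt.ne', ← Real.rpow_add hrt,
        show p + 1 + 1 + 2 * (-p / 2 - 1) = 0 by ring, Real.rpow_zero]
    have h4 : 0 ≤ p * (r ^ 2) ^ (-p / 2 - 1) := by positivity
    have h5 := mul_le_mul_of_nonneg_left hI h4
    calc -p * ⟪Q (x t), y t⟫ * (r ^ 2) ^ (-p / 2 - 1)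
        = p * (r ^ 2) ^ (-p / 2 - 1) * -⟪Q (x t), y t⟫ := by ring
      _ ≤ p * (r ^ 2) ^ (-p / 2 - 1) * (r * (2 * √M * r ^ (p + 1))) := h5
      _ = 2 * √M * p * (r * r ^ (p + 1) * (r ^ 2) ^ (-p / 2 - 1)) := by ring
      _ = 2 * √M * p := by rw [hpow, mul_one]

/-- At a first zero of `u`, the lower bound valid before that time would be violated. -/
theorem IsWaveSolution.ne_zero (h0 : Q (x 0) ≠ 0) : ∀ t ∈ Icc 0 T, Q (x t) ≠ 0 := by
  by_contra! hcon
  obtain ⟨t₁, ht₁, hz⟩ := hcon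
  have hp := hb.p_pos
  have hMpos := hb.M_pos
  have hcont : ContinuousOn (fun t => ‖Q (x t)‖) (Icc 0 T) :=
    (Q.continuous.comp_continuousOn hw.cont_x).norm
  let C : Set ℝ := Icc 0 T ∩ (fun t => ‖Q (x t)‖) ⁻¹' {0}
  have hC : IsCompact C :=
    isCompact_Icc.of_isClosed_subset (hcont.preimage_isClosed_of_isClosed isClosed_Icc
      isClosed_singleton) inter_subset_left
  obtain ⟨τ, ⟨hτ, hτ0⟩, hmin⟩ := hC.exists_isLeast ⟨t₁, ht₁, norm_eq_zero.2 hz⟩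
  have hτ0' : ‖Q (x τ)‖ = 0 := hτ0
  have hne : ∀ t ∈ Ico 0 τ, Q (x t) ≠ 0 := fun t ht h =>
    (hmin ⟨⟨ht.1, ht.2.le.trans hτ.2⟩, norm_eq_zero.2 h⟩).not_gt ht.2
  have hτpos : 0 < τ := by
    rcases hτ.1.eq_or_lt with h | h
    · rw [← h] at hτ0'
      exact absurd (norm_eq_zero.1 hτ0') h0
    · exact h
  set E := ‖Q (x 0)‖ ^ (-p) + 2 * √M * p * τ with hE
  have hEpos : 0 < E := by
    have := Real.rpow_pos_of_pos (norm_pos_iff.2 h0) (-p)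
    positivity
  -- before the first zero the norm has a positive lower bound
  have hlow : ∀ t ∈ Ico 0 τ, E ^ (-p⁻¹) ≤ ‖Q (x t)‖ := by
    intro t ht
    have h1 := IsWaveSolution.norm_rpow_neg_le_of_ne_zero hQ hf hf0 hκ hκ1 hco hb
      (hw.mono (ht.2.le.trans hτ.2)) hen hinit
      (fun s hs => hne s ⟨hs.1, hs.2.trans_lt ht.2⟩) ht.1
    have h2 : ‖Q (x t)‖ ^ (-p) ≤ E := by
      refine h1.trans ?_
      rw [hE]
      have := ht.2.le
      gcongr
    have hrt : 0 < ‖Q (x t)‖ := norm_pos_iff.2 (hne t ht)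
    have h3 := Real.rpow_le_rpow_of_nonpos (Real.rpow_pos_of_pos hrt _) h2
      (show -p⁻¹ ≤ 0 by simpa using hp.le)
    rwa [← Real.rpow_mul hrt.le, neg_mul_neg, mul_inv_cancel₀ hp.ne', Real.rpow_one] at h3
  have hclosed : IsClosed (Icc 0 τ ∩ (fun t => ‖Q (x t)‖) ⁻¹' Ici (E ^ (-p⁻¹))) :=
    (hcont.mono (Icc_subset_Icc_right hτ.2)).preimage_isClosed_of_isClosed isClosed_Icc isClosed_Ici
  have hsub : closure (Ico 0 τ) ⊆ Icc 0 τ ∩ (fun t => ‖Q (x t)‖) ⁻¹' Ici (E ^ (-p⁻¹)) :=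
    closure_minimal (fun t ht => ⟨Ico_subset_Icc_self ht, hlow t ht⟩) hclosed
  rw [closure_Ico hτpos.ne] at hsub
  have h1 : E ^ (-p⁻¹) ≤ ‖Q (x τ)‖ := (hsub (right_mem_Icc.2 hτpos.le)).2
  rw [hτ0'] at h1
  exact h1.not_gt (Real.rpow_pos_of_pos hEpos _)

/-- The lower bound for `|u|`, in the form `|u(T)| ^ (-p) ≤ |u(0)| ^ (-p) + 2 √M p T`. -/
theorem IsWaveSolution.norm_rpow_neg_le (h0 : Q (x 0) ≠ 0) (hT : 0 ≤ T) :
    0 < ‖Q (x T)‖ ∧ ‖Q (x T)‖ ^ (-p) ≤ ‖Q (x 0)‖ ^ (-p) + 2 * √M * p * T := by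
  have hne := hw.ne_zero hQ hf hf0 hκ hκ1 hco hb hen hinit h0
  exact ⟨norm_pos_iff.2 (hne T (right_mem_Icc.2 hT)),
    hw.norm_rpow_neg_le_of_ne_zero hQ hf hf0 hκ hκ1 hco hb hen hinit hne hT⟩

end

/-- Choice of the constants: `M` is dictated by the gradient bound, then `δ` is taken small in
terms of `M`, and `η` small in terms of `δ`. -/
theorem exists_barrierConstants {g : H → H} {p c R α ρ : ℝ} (hp : 0 < p) (hc : 0 < c) (hR : 0 < R)
    (hα : 0 < α) (hρ : 0 < ρ)
    (hg : ∀ x, √(‖Q x‖ ^ 2 + ‖x - Q x‖ ^ 2) ≤ ρ →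
      ‖g x‖ ≤ R * (‖Q x‖ ^ (p + 1) + ‖x - Q x‖ ^ (1 + α))) :
    ∃ M δ η, 0 < η ∧ BarrierConstants Q g p c R M δ α η := by
  set M := 16 * R ^ 2 / c + 1 with hM
  have hMpos : 0 < M := by positivity
  have hpow : ∀ {a : ℝ}, 0 < a → Tendsto (fun s : ℝ => s ^ a) (𝓝[>] 0) (𝓝 0) := by
    intro a ha
    have h1 := (Real.continuousAt_rpow_const 0 a (Or.inr ha.le)).tendsto
    rw [Real.zero_rpow ha.ne'] at h1
    exact h1.mono_left nhdsWithin_le_nhds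
  have hid : Tendsto (fun s : ℝ => s) (𝓝[>] 0) (𝓝 0) := tendsto_id.mono_left nhdsWithin_le_nhds
  obtain ⟨δ, hδ1, hδ2, hδ⟩ : ∃ δ : ℝ, 4 * (p + 1) * √M * δ ^ p < c / 4 ∧ δ < ρ / 2 ∧ 0 < δ := by
    have h1 : Tendsto (fun s : ℝ => 4 * (p + 1) * √M * s ^ p) (𝓝[>] 0) (𝓝 0) := by
      simpa using (hpow hp).const_mul (4 * (p + 1) * √M)
    exact ((h1.eventually (gt_mem_nhds (show 0 < c / 4 by positivity))).and
      ((hid.eventually (gt_mem_nhds (show 0 < ρ / 2 by positivity))).and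
        self_mem_nhdsWithin)).exists
  have hδM : 0 < M * (δ ^ 2) ^ (p + 1) := by positivity
  obtain ⟨η, hη1, hη2, hη3, hη⟩ : ∃ η : ℝ, 4 * R ^ 2 * (2 * η) ^ α < c / 2 ∧
      2 * η < M * (δ ^ 2) ^ (p + 1) ∧ 2 * η < ρ ^ 2 / 2 ∧ 0 < η := by
    have h2 : Tendsto (fun s : ℝ => 2 * s) (𝓝[>] 0) (𝓝[>] 0) := by
      refine tendsto_nhdsWithin_iff.2 ⟨by simpa using hid.const_mul 2, ?_⟩
      filter_upwards [self_mem_nhdsWithin] with s hs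
      have hs' : (0 : ℝ) < s := hs
      exact mem_Ioi.2 (by positivity)
    have h1 : Tendsto (fun s : ℝ => 4 * R ^ 2 * (2 * s) ^ α) (𝓝[>] 0) (𝓝 0) := by
      simpa using ((hpow hα).comp h2).const_mul (4 * R ^ 2)
    have h3 : Tendsto (fun s : ℝ => 2 * s) (𝓝[>] 0) (𝓝 0) := h2.mono_right nhdsWithin_le_nhds
    exact ((h1.eventually (gt_mem_nhds (show 0 < c / 2 by positivity))).and
      ((h3.eventually (gt_mem_nhds hδM)).and
        ((h3.eventually (gt_mem_nhds (show 0 < ρ ^ 2 / 2 by positivity))).and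
          self_mem_nhdsWithin))).exists
  refine ⟨M, δ, η, hη, hp, hc, hR, hδ, hα, hM, hδ1.le, hη1.le, hη2, fun x hx hx' => hg x ?_⟩
  refine Real.sqrt_le_iff.2 ⟨hρ.le, ?_⟩
  have h1 : ‖Q x‖ ^ 2 ≤ (ρ / 2) ^ 2 := pow_le_pow_left₀ (norm_nonneg _) (hx.trans hδ2.le) 2
  nlinarith

end SlowSolution

/-! ### Weak solutions in `D(A^{1/2})` and the first-order system -/

section Translation

variable {H : Type*} [NormedAddCommGroup H] [InnerProductSpace ℝ H] [CompleteSpace H]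
  {A : H →ₗ.[ℝ] H}

open SqrtDomain

theorem isNonnegSqrt_opSqrt (hA : IsSelfAdjoint A) (hA0 : IsNonneg A) :
    IsNonnegSqrt A (opSqrt A) := by
  have h := exists_isNonnegSqrt hA hA0
  rw [opSqrt, dif_pos h]
  exact h.choose_spec

namespace SqrtDomain

theorem toH_injective : Function.Injective (toH (A := A)) := Subtype.val_injective

theorem norm_toH_le (v : SqrtDomain A) : ‖toH v‖ ≤ ‖v‖ := by
  rw [norm_eq]
  exact Real.le_sqrt_of_sq_le (by linarith [sq_nonneg ‖sqrtOp v‖])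

theorem norm_sqrtOp_le (v : SqrtDomain A) : ‖sqrtOp v‖ ≤ ‖v‖ := by
  rw [norm_eq]
  exact Real.le_sqrt_of_sq_le (by linarith [sq_nonneg ‖toH v‖])

theorem continuous_toH : Continuous (toH (A := A)) :=
  (toH.mkContinuous 1 fun v => by rw [one_mul]; exact norm_toH_le v).continuous

theorem continuous_sqrtOp : Continuous (sqrtOp (A := A)) :=
  (sqrtOp.mkContinuous 1 fun v => by rw [one_mul]; exact norm_sqrtOp_le v).continuous

/-- The operator `1 + A^{1/2}` from `D(A^{1/2})` to `H`. -/
def oneAddSqrt : SqrtDomain A →ₗ[ℝ] H := toH + sqrtOp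

theorem oneAddSqrt_apply (v : SqrtDomain A) : oneAddSqrt v = toH v + sqrtOp v := rfl

theorem continuous_oneAddSqrt : Continuous (oneAddSqrt (A := A)) :=
  continuous_toH.add continuous_sqrtOp

end SqrtDomain

/-- The weak time derivative, tested against `φ = (1 + A^{1/2})⁻¹ ψ`, in the variable
`x = (1 + A^{1/2}) u`. -/
theorem inner_waveForce {B : H →ₗ.[ℝ] H} {Q : H →L[ℝ] H} (hQ : IsResolvent B Q) (g : H → H)
    (x y ψ : H) :
    ⟪-x + Q (waveForce Q g x y), ψ⟫ =
      -(⟪y, Q ψ⟫ + ⟪x - Q x, ψ - Q ψ⟫ + ⟪g x, Q ψ⟫) := by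
  rw [inner_add_left, hQ.inner_comm, waveForce]
  simp only [inner_sub_left, inner_sub_right, inner_neg_left, real_inner_smul_left]
  rw [hQ.inner_comm x ψ]
  ring

theorem Icc_mem_nhdsWithin_Ici {t T : ℝ} (ht : t < T) : Icc 0 T ∈ 𝓝[Ici 0] t :=
  inter_mem self_mem_nhdsWithin (mem_nhdsWithin_of_mem_nhds (Iic_mem_nhds ht))

namespace IsResolvent

variable {Q : H →L[ℝ] H} (hQ : IsResolvent (opSqrt A) Q)

/-- The resolvent `(1 + A^{1/2})⁻¹`, as a map from `H` to `D(A^{1/2})`. -/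
def lift : H →ₗ[ℝ] SqrtDomain A :=
  LinearMap.codRestrict (opSqrt A).domain (Q : H →ₗ[ℝ] H) fun w =>
    LinearPMap.mem_domain_of_mem_graph (hQ.mem_graph w)

theorem toH_lift (x : H) : toH (hQ.lift x) = Q x := rfl

theorem sqrtOp_lift (x : H) : sqrtOp (hQ.lift x) = x - Q x :=
  LinearPMap.mem_graph_snd_inj (opSqrt A) ((opSqrt A).mem_graph (hQ.lift x)) (hQ.mem_graph x) rfl

include hQ in
theorem apply_oneAddSqrt (v : SqrtDomain A) : Q (oneAddSqrt v) = toH v :=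
  hQ.apply_add _ _ ((opSqrt A).mem_graph v)

theorem lift_oneAddSqrt (v : SqrtDomain A) : hQ.lift (oneAddSqrt v) = v :=
  toH_injective (by rw [hQ.toH_lift, hQ.apply_oneAddSqrt])

theorem norm_lift (x : H) : ‖hQ.lift x‖ = √(‖Q x‖ ^ 2 + ‖x - Q x‖ ^ 2) := by
  rw [SqrtDomain.norm_eq, hQ.toH_lift, hQ.sqrtOp_lift]

theorem norm_lift_le (x : H) : ‖hQ.lift x‖ ≤ ‖x‖ := by
  rw [hQ.norm_lift, Real.sqrt_le_iff]
  refine ⟨norm_nonneg _, ?_⟩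
  have h1 := hQ.sq_norm_le x
  rw [norm_sub_sq_real, real_inner_comm]
  linarith

theorem continuous_lift : Continuous hQ.lift :=
  (hQ.lift.mkContinuous 1 fun v => by rw [one_mul]; exact hQ.norm_lift_le v).continuous

theorem isBddLipschitz_lift {G : SqrtDomain A → H} (hG : IsLocLipschitz G) :
    IsBddLipschitz fun x => G (hQ.lift x) := by
  obtain ⟨L, hL, hGL⟩ := hG
  intro R
  obtain ⟨C, hC⟩ := (hL (Icc 0 R ×ˢ Icc 0 R)
    ((Metric.isBounded_Icc 0 R).prod (Metric.isBounded_Icc 0 R))).exists_norm_le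
  refine ⟨C.toNNReal, LipschitzOnWith.of_dist_le_mul fun x hx z hz => ?_⟩
  rw [mem_closedBall_zero_iff] at hx hz
  have hmem : ∀ {x : H}, ‖x‖ ≤ R → ‖hQ.lift x‖ ∈ Icc 0 R := fun h =>
    ⟨norm_nonneg _, (hQ.norm_lift_le _).trans h⟩
  have h1 : L (‖hQ.lift x‖, ‖hQ.lift z‖) ≤ C.toNNReal :=
    (le_abs_self _).trans ((hC _ ⟨_, ⟨hmem hx, hmem hz⟩, rfl⟩).trans (Real.le_coe_toNNReal C))
  rw [dist_eq_norm, dist_eq_norm]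
  refine (hGL _ _).trans ?_
  refine mul_le_mul h1 ?_ (norm_nonneg _) (NNReal.coe_nonneg _)
  rw [← map_sub]
  exact hQ.norm_lift_le _

theorem isPotential_lift {F : SqrtDomain A → ℝ} {G : SqrtDomain A → H} (hF : IsGradient F G) :
    IsPotential Q (fun x => F (hQ.lift x)) fun x => G (hQ.lift x) := by
  intro x
  rw [Asymptotics.isLittleO_iff]
  intro c hc
  have h1 := (hF (hQ.lift x)).eventually (Metric.ball_mem_nhds 0 hc)
  rw [eventually_nhdsWithin_iff] at h1
  have h2 : Tendsto hQ.lift (𝓝 0) (𝓝 0) := by simpa using hQ.continuous_lift.tendsto 0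
  filter_upwards [h2.eventually h1] with v hv
  rw [map_add, ← hQ.toH_lift v]
  rcases eq_or_ne (hQ.lift v) 0 with h0 | h0
  · simp [h0]
  · have h3 : 0 < ‖toH (hQ.lift v)‖ :=
      norm_pos_iff.2 fun h => h0 (toH_injective (by rw [h, map_zero]))
    have h4 := hv h0
    rw [dist_zero_right, norm_div, norm_norm, div_lt_iff₀ h3] at h4
    exact h4.le

/-- The kernel of `A` is contained in the kernel of its square root. -/
theorem apply_of_mem_opKer (hB : IsNonnegSqrt A (opSqrt A)) (hQ : IsResolvent (opSqrt A) Q) {k : H}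
    (hk : k ∈ opKer A) : Q k = k := by
  obtain ⟨a, ha, rfl⟩ := hk
  have h1 : ((a : H), (0 : H)) ∈ A.graph := by
    have h2 := A.mem_graph a
    rwa [show A a = 0 from ha] at h2
  obtain ⟨z, hz1, hz2⟩ := (hB.sq_eq _ _).1 h1
  have h3 := inner_graph_comm hB.selfAdjoint hz1 hz2
  rw [inner_zero_right, inner_self_eq_zero] at h3
  rw [h3] at hz1
  simpa using hQ.apply_add _ _ hz1

include hQ in
/-- The coercivity of `A^{1/2}` off the kernel, rewritten for `A^{1/2} (1 + A^{1/2})⁻¹` on the range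
of `A^{1/2}`, which is orthogonal to the kernel. -/
theorem exists_coercive (hB : IsNonnegSqrt A (opSqrt A)) {ν : ℝ} (hν : 0 < ν)
    (hco : ∀ u : SqrtDomain A, toH u ∈ (opKer A)ᗮ → ν * ‖toH u‖ ^ 2 ≤ ‖sqrtOp u‖ ^ 2) :
    ∃ κ : ℝ, 0 < κ ∧ κ ≤ 1 ∧
      ∀ x, κ * ‖x - Q x‖ ^ 2 ≤ ⟪x - Q x, (x - Q x) - Q (x - Q x)⟫ := by
  refine ⟨ν / (2 * (1 + ν)), by positivity, ?_, fun x => ?_⟩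
  · rw [div_le_one (by positivity)]; linarith
  set v := x - Q x with hv
  have horth : toH (hQ.lift v) ∈ (opKer A)ᗮ := by
    rw [Submodule.mem_orthogonal']
    intro k hk
    have hkQ := apply_of_mem_opKer hB hQ hk
    rw [hQ.toH_lift, hQ.inner_comm, hkQ, hv, inner_sub_left, hQ.inner_comm, hkQ, sub_self]
  have h1 := hco _ horth
  rw [hQ.toH_lift, hQ.sqrtOp_lift] at h1
  have h2 : ‖v - Q v‖ ^ 2 ≤ ⟪v, v - Q v⟫ := by
    have h3 := hQ.sq_norm_le v
    rw [norm_sub_sq_real, inner_sub_right, real_inner_self_eq_norm_sq]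
    rw [real_inner_comm] at h3
    linarith
  have h4 : ‖v‖ ^ 2 ≤ 2 * ‖Q v‖ ^ 2 + 2 * ‖v - Q v‖ ^ 2 := by
    have h5 := norm_add_le (Q v) (v - Q v)
    rw [add_sub_cancel] at h5
    nlinarith [norm_nonneg v, sq_nonneg (‖Q v‖ - ‖v - Q v‖)]
  rw [div_mul_eq_mul_div, div_le_iff₀ (by positivity)]
  nlinarith

/-- Global solutions of the first-order system are weak solutions of the wave equation. -/
theorem isWeakSolution {G : SqrtDomain A → H} {x y : ℝ → H}
    (hw : ∀ T, IsWaveSolution Q (fun x => G (hQ.lift x)) x y T) :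
    IsWeakSolution G (hQ.lift (x 0)) (y 0) fun t => hQ.lift (x t) := by
  have hx : ∀ t, 0 ≤ t → HasDerivWithinAt (fun τ => Q (x τ)) (y t) (Ici 0) t := fun t ht =>
    ((hw (t + 1)).deriv_x t ⟨ht, by linarith⟩).mono_of_mem_nhdsWithin
      (Icc_mem_nhdsWithin_Ici (by linarith))
  have hcont : ∀ z : ℝ → H, (∀ T, ContinuousOn z (Icc 0 T)) → ContinuousOn z (Ici 0) :=
    fun z hz t ht => (hz (t + 1) t ⟨ht, by linarith⟩).mono_of_mem_nhdsWithin
      (Icc_mem_nhdsWithin_Ici (by linarith))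
  have hder : ∀ t, 0 ≤ t → timeDeriv (fun t => hQ.lift (x t)) t = y t := fun t ht =>
    (hx t ht).derivWithin (uniqueDiffOn_Ici 0 t ht)
  refine ⟨hQ.continuous_lift.comp_continuousOn (hcont x fun T => (hw T).cont_x), ?_, rfl,
    hder 0 le_rfl, fun φ t ht => ?_⟩
  · rw [contDiffOn_one_iff_derivWithin (uniqueDiffOn_Ici 0)]
    exact ⟨fun t ht => (hx t ht).differentiableWithinAt,
      (hcont y fun T => (hw T).cont_y).congr fun t ht => hder t ht⟩
  · have h1 : HasDerivWithinAt (fun τ => Q (y τ))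
        (-x t + Q (waveForce Q (fun x => G (hQ.lift x)) (x t) (y t))) (Ici 0) t :=
      ((hw (t + 1)).deriv_y t ⟨ht, by linarith⟩).mono_of_mem_nhdsWithin
        (Icc_mem_nhdsWithin_Ici (by linarith))
    have h2 := h1.inner ℝ (hasDerivWithinAt_const t (Ici 0) (oneAddSqrt φ))
    rw [inner_zero_right, zero_add, inner_waveForce hQ] at h2
    have h3 : oneAddSqrt φ - Q (oneAddSqrt φ) = sqrtOp φ := by
      rw [hQ.apply_oneAddSqrt, oneAddSqrt_apply, add_sub_cancel_left]
    rw [h3, hQ.apply_oneAddSqrt] at h2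
    have h4 : ∀ s ∈ Ici (0 : ℝ), ⟪timeDeriv (fun t => hQ.lift (x t)) s, toH φ⟫ =
        ⟪Q (y s), oneAddSqrt φ⟫ := by
      intro s hs
      rw [hder s hs, hQ.inner_comm, hQ.apply_oneAddSqrt]
    rw [hder t ht, hQ.sqrtOp_lift]
    exact h2.congr h4 (h4 t ht)

/-- A weak solution satisfies the first-order system: its equation says that `Q u'` has a
continuous weak derivative, hence a strong one. -/
theorem isWaveSolution {G : SqrtDomain A → H} (hG : IsLocLipschitz G) {u₀ : SqrtDomain A} {u₁ : H}
    {u : ℝ → SqrtDomain A} (hu : IsWeakSolution G u₀ u₁ u) (T : ℝ) :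
    IsWaveSolution Q (fun x => G (hQ.lift x)) (fun t => oneAddSqrt (u t)) (timeDeriv u) T := by
  rcases lt_or_ge T 0 with hT | hT
  · have hempty : Icc 0 T = ∅ := Icc_eq_empty (not_le.2 hT)
    constructor <;> simp [hempty]
  have hsub : Icc 0 T ⊆ Ici 0 := Icc_subset_Ici_self
  set g : H → H := fun x => G (hQ.lift x) with hg
  have hgc : Continuous g := (hQ.isBddLipschitz_lift hG).continuous
  have hx : ContinuousOn (fun t => oneAddSqrt (u t)) (Icc 0 T) :=
    continuous_oneAddSqrt.comp_continuousOn (hu.continuousOn.mono hsub)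
  obtain ⟨hdiff, hcont⟩ := (contDiffOn_one_iff_derivWithin (uniqueDiffOn_Ici 0)).1 hu.contDiffOn
  have hy : ContinuousOn (timeDeriv u) (Icc 0 T) := hcont.mono hsub
  have hh : ContinuousOn (fun t => waveForce Q g (oneAddSqrt (u t)) (timeDeriv u t)) (Icc 0 T) :=
    (((hx.const_smul (2 : ℝ)).sub (Q.continuous.comp_continuousOn hx)).sub hy).sub
      (hgc.comp_continuousOn hx)
  have hk : ContinuousOn (fun t => -oneAddSqrt (u t) +
      Q (waveForce Q g (oneAddSqrt (u t)) (timeDeriv u t))) (Icc 0 T) :=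
    hx.neg.add (Q.continuous.comp_continuousOn hh)
  refine ⟨hx, hy, hh, fun t ht => ?_, fun t ht => ?_⟩
  · simp_rw [hQ.apply_oneAddSqrt]
    exact ((hdiff t (hsub ht)).hasDerivWithinAt).mono hsub
  · obtain ⟨K, hK0, hK⟩ := exists_hasDerivWithinAt_of_continuousOn hT hk (Q (timeDeriv u 0))
    have hweak : ∀ ψ : H, ∀ t ∈ Icc 0 T, HasDerivWithinAt (fun τ => ⟪Q (timeDeriv u τ), ψ⟫)
        ⟪-oneAddSqrt (u t) + Q (waveForce Q g (oneAddSqrt (u t)) (timeDeriv u t)), ψ⟫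
        (Icc 0 T) t := by
      intro ψ t ht
      have h1 := (hu.equation (hQ.lift ψ) t ht.1).mono hsub
      simp_rw [hQ.toH_lift, hQ.sqrtOp_lift, ← hQ.inner_comm _ ψ] at h1
      refine h1.congr_deriv ?_
      rw [inner_waveForce hQ, hQ.apply_oneAddSqrt, oneAddSqrt_apply, add_sub_cancel_left, hg]
      simp only [← oneAddSqrt_apply, hQ.lift_oneAddSqrt, hQ.inner_comm]
    have heq : EqOn (fun τ => Q (timeDeriv u τ)) K (Icc 0 T) := by
      intro s hs
      refine ext_inner_right ℝ fun ψ => ?_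
      refine eqOn_of_hasDerivWithinAt_eq (g := fun τ => ⟪K τ, ψ⟫) (hweak ψ) (fun t ht => ?_)
        (by simp only [hK0]) hs
      have h2 := (hK t ht).inner ℝ (hasDerivWithinAt_const t (Icc 0 T) ψ)
      rwa [inner_zero_right, zero_add] at h2
    exact (hK t ht).congr heq (heq ht)

include hQ in
/-- The data are taken near `(s e, 0)` with `e ∈ ker A` and `s` small: there the energy is small
because `F` is continuous and `F 0 = 0`, while `|u₀|` is bounded below and `|u₁|² + |A^{1/2} u₀|²`
is small compared with `|u₀| ^ (2p+2)`. -/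
theorem exists_slow_solutions (hB : IsNonnegSqrt A (opSqrt A)) {F : SqrtDomain A → ℝ}
    (hF_nonneg : ∀ u, 0 ≤ F u) (hF_zero : F 0 = 0) {G : SqrtDomain A → H} (hF_grad : IsGradient F G)
    (hF_lip : IsLocLipschitz G) (hA_ker : opKer A ≠ ⊥)
    (hA_coercive : ∃ ν : ℝ, 0 < ν ∧ ∀ u : SqrtDomain A,
      toH u ∈ (opKer A)ᗮ → ν * ‖toH u‖ ^ 2 ≤ ‖sqrtOp u‖ ^ 2)
    {p : ℝ} (hp : 0 < p)
    (hF_small : ∃ ρ R α : ℝ, 0 < ρ ∧ 0 < R ∧ 0 < α ∧ ∀ u : SqrtDomain A, ‖u‖ ≤ ρ →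
      ‖G u‖ ≤ R * (‖toH u‖ ^ (p + 1) + ‖sqrtOp u‖ ^ (1 + α))) :
    ∃ S : Set (SqrtDomain A × H), IsOpen S ∧ S.Nonempty ∧
      ∃ M₃ : ℝ, 0 < M₃ ∧ ∀ u₀ : SqrtDomain A, ∀ u₁ : H, (u₀, u₁) ∈ S →
        ∃ u : ℝ → SqrtDomain A, IsWeakSolution G u₀ u₁ u ∧
          (∀ v : ℝ → SqrtDomain A, IsWeakSolution G u₀ u₁ v → ∀ t : ℝ, 0 ≤ t → v t = u t) ∧
          ∀ t : ℝ, 0 ≤ t → M₃ / (1 + t) ^ (1 / p) ≤ ‖toH (u t)‖ := by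
  obtain ⟨ν, hν, hco⟩ := hA_coercive
  obtain ⟨κ, hκ, hκ1, hκco⟩ := hQ.exists_coercive hB hν hco
  obtain ⟨ρ, R, α, hρ, hR, hα, hsmall⟩ := hF_small
  have hg := hQ.isBddLipschitz_lift hF_lip
  have hf := hQ.isPotential_lift hF_grad
  have hf0 : ∀ x, 0 ≤ F (hQ.lift x) := fun x => hF_nonneg _
  obtain ⟨M, δ, η, hη, hb⟩ := exists_barrierConstants (Q := Q) (g := fun x => G (hQ.lift x)) hp
    (show 0 < κ ^ 2 / 16 by positivity) hR hα hρ fun x hx => by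
      have h1 := hsmall (hQ.lift x) (by rwa [hQ.norm_lift])
      rwa [hQ.toH_lift, hQ.sqrtOp_lift] at h1
  have hMpos := hb.M_pos
  have hFc : Continuous F := by
    have h1 : F = fun u => F (hQ.lift (oneAddSqrt u)) := by
      funext u; rw [hQ.lift_oneAddSqrt]
    rw [h1]
    exact hf.continuous.comp continuous_oneAddSqrt
  obtain ⟨e, he, he0⟩ := Submodule.exists_mem_ne_zero_of_ne_bot hA_ker
  -- the centre `s e` of the set of initial positions, with `e` in the kernel of `A`
  obtain ⟨s, hs, hspos⟩ : ∃ s : ℝ, F (hQ.lift (s • e)) < η ∧ 0 < s := by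
    have h1 : Tendsto (fun s : ℝ => F (hQ.lift (s • e))) (𝓝 0) (𝓝 0) := by
      have h2 : Continuous fun s : ℝ => F (hQ.lift (s • e)) :=
        hf.continuous.comp (continuous_id.smul continuous_const)
      simpa [hF_zero] using h2.tendsto 0
    have h3 : ∀ᶠ s : ℝ in 𝓝[>] 0, 0 < s := self_mem_nhdsWithin
    exact (((h1.mono_left nhdsWithin_le_nhds).eventually (gt_mem_nhds hη)).and h3).exists
  have hQe : Q (s • e) = s • e := by rw [map_smul, apply_of_mem_opKer hB hQ he]
  have hse : 0 < ‖s • e‖ := norm_pos_iff.2 (smul_ne_zero hspos.ne' he0)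
  let m := ‖s • e‖ / 2
  have hm : 0 < m := by positivity
  let S : Set (SqrtDomain A × H) := {z | m < ‖toH z.1‖ ∧
    ‖z.2‖ ^ 2 + ‖sqrtOp z.1‖ ^ 2 < M * (‖toH z.1‖ ^ 2) ^ (p + 1) ∧
    (‖z.2‖ ^ 2 + ‖sqrtOp z.1‖ ^ 2) / 2 + F z.1 < η}
  have hSopen : IsOpen S := by
    have hc1 : Continuous fun z : SqrtDomain A × H => ‖toH z.1‖ :=
      (continuous_toH.comp continuous_fst).norm
    have hc2 : Continuous fun z : SqrtDomain A × H => ‖z.2‖ ^ 2 + ‖sqrtOp z.1‖ ^ 2 :=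
      (continuous_snd.norm.pow 2).add ((continuous_sqrtOp.comp continuous_fst).norm.pow 2)
    refine (isOpen_lt continuous_const hc1).inter ((isOpen_lt hc2 ?_).inter
      (isOpen_lt ((hc2.div_const 2).add (hFc.comp continuous_fst)) continuous_const))
    exact continuous_const.mul ((hc1.pow 2).rpow_const fun _ => Or.inr (by linarith))
  have hSne : (hQ.lift (s • e), (0 : H)) ∈ S := by
    refine ⟨?_, ?_, ?_⟩
    · rw [hQ.toH_lift, hQe]
      exact half_lt_self hse
    · rw [hQ.toH_lift, hQ.sqrtOp_lift, hQe, sub_self, norm_zero]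
      have : 0 < M * (‖s • e‖ ^ 2) ^ (p + 1) := by positivity
      simpa using this
    · rw [hQ.sqrtOp_lift, hQe, sub_self, norm_zero]
      simpa using hs
  let D := m ^ (-p) + 2 * √M * p
  have hD : 0 < D := by positivity
  refine ⟨S, hSopen, ⟨_, hSne⟩, D ^ (-p⁻¹), Real.rpow_pos_of_pos hD _, ?_⟩
  rintro u₀ u₁ ⟨hS1, hS2, hS3⟩
  dsimp only at hS1 hS2 hS3
  obtain ⟨x, y, hw, hx0, hy0⟩ := exists_forall_isWaveSolution hQ hf hg hf0 (oneAddSqrt u₀) u₁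
  have hu := hQ.isWeakSolution hw
  rw [hx0, hy0, hQ.lift_oneAddSqrt] at hu
  have hsq : oneAddSqrt u₀ - Q (oneAddSqrt u₀) = sqrtOp u₀ := by
    rw [hQ.apply_oneAddSqrt, oneAddSqrt_apply, add_sub_cancel_left]
  refine ⟨_, hu, fun v hv t ht => ?_, fun t ht => ?_⟩
  · have hv' := hQ.isWaveSolution hF_lip hv t
    have h1 := (IsWaveSolution.eqOn hQ hg hv' (hw t) (by rw [hv.init, hx0])
      (by rw [hv.init_deriv, hy0])).1 (right_mem_Icc.2 ht)
    dsimp only at h1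
    rw [← h1, hQ.lift_oneAddSqrt]
  · have hQ0 : Q (x 0) = toH u₀ := by rw [hx0, hQ.apply_oneAddSqrt]
    have hmain := (hw t).norm_rpow_neg_le hQ hf hf0 hκ hκ1 hκco hb
      (by
        rw [hx0, hy0, linEnergy, hsq, hQ.lift_oneAddSqrt]
        exact hS3.le)
      (by
        rw [hx0, hy0, hsq, hQ.apply_oneAddSqrt]
        exact hS2.le)
      (by
        rw [hQ0]
        exact norm_pos_iff.1 (hm.trans hS1)) ht
    rw [hQ0] at hmain
    obtain ⟨hr, hle⟩ := hmain
    have h1 : ‖Q (x t)‖ ^ (-p) ≤ D * (1 + t) := by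
      have h2 : ‖toH u₀‖ ^ (-p) ≤ m ^ (-p) :=
        Real.rpow_le_rpow_of_nonpos hm hS1.le (by linarith)
      have h3 : 0 ≤ m ^ (-p) * t := by positivity
      have h4 : 0 ≤ 2 * √M * p := by positivity
      have h5 : D * (1 + t) = m ^ (-p) + m ^ (-p) * t + (2 * √M * p + 2 * √M * p * t) := by
        simp only [D]; ring
      rw [h5]
      linarith
    have h6 := Real.rpow_le_rpow_of_nonpos (Real.rpow_pos_of_pos hr _) h1
      (show -p⁻¹ ≤ 0 by simpa using hp.le)
    rw [← Real.rpow_mul hr.le, neg_mul_neg, mul_inv_cancel₀ hp.ne', Real.rpow_one,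
      Real.mul_rpow hD.le (by linarith), Real.rpow_neg (show 0 ≤ 1 + t by linarith)] at h6
    rw [hQ.toH_lift, one_div, div_eq_mul_inv]
    exact h6

end IsResolvent

end Translation

end SlowSolutions

end

theorem theorem2p3 {H : Type*} [NormedAddCommGroup H] [InnerProductSpace ℝ H] [CompleteSpace H]
    (A : H →ₗ.[ℝ] H) (hA_dense : Dense (A.domain : Set H)) (hA_sa : IsSelfAdjoint A)
    (hA_nonneg : SlowSolutions.IsNonneg A)
    (F : SlowSolutions.SqrtDomain A → ℝ) (hF_nonneg : ∀ u, 0 ≤ F u) (hF_zero : F 0 = 0)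
    (gradF : SlowSolutions.SqrtDomain A → H)
    (hF_grad : SlowSolutions.IsGradient F gradF)
    (hF_lip : SlowSolutions.IsLocLipschitz gradF)
    (hA_ker : SlowSolutions.opKer A ≠ ⊥)
    (hA_coercive : ∃ ν : ℝ, 0 < ν ∧ ∀ u : SlowSolutions.SqrtDomain A,
      SlowSolutions.SqrtDomain.toH u ∈ (SlowSolutions.opKer A)ᗮ →
        ν * ‖SlowSolutions.SqrtDomain.toH u‖ ^ 2 ≤ ‖SlowSolutions.SqrtDomain.sqrtOp u‖ ^ 2)
    (p : ℝ) (hp : 0 < p)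
    (hF_small : ∃ ρ R α : ℝ, 0 < ρ ∧ 0 < R ∧ 0 < α ∧
      ∀ u : SlowSolutions.SqrtDomain A, ‖u‖ ≤ ρ →
        ‖gradF u‖ ≤ R * (‖SlowSolutions.SqrtDomain.toH u‖ ^ (p + 1)
          + ‖SlowSolutions.SqrtDomain.sqrtOp u‖ ^ (1 + α))) :
    ∃ S : Set (SlowSolutions.SqrtDomain A × H), IsOpen S ∧ S.Nonempty ∧
      ∃ M₃ : ℝ, 0 < M₃ ∧ ∀ u₀ : SlowSolutions.SqrtDomain A, ∀ u₁ : H, (u₀, u₁) ∈ S →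
        ∃ u : ℝ → SlowSolutions.SqrtDomain A,
          SlowSolutions.IsWeakSolution gradF u₀ u₁ u ∧
          (∀ v : ℝ → SlowSolutions.SqrtDomain A,
            SlowSolutions.IsWeakSolution gradF u₀ u₁ v → ∀ t : ℝ, 0 ≤ t → v t = u t) ∧
          ∀ t : ℝ, 0 ≤ t → M₃ / (1 + t) ^ (1 / p) ≤ ‖SlowSolutions.SqrtDomain.toH (u t)‖ := by
  have hB := SlowSolutions.isNonnegSqrt_opSqrt hA_sa hA_nonneg
  obtain ⟨Q, hQ⟩ := SlowSolutions.exists_isResolvent hB.selfAdjoint hB.nonneg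
  exact hQ.exists_slow_solutions hB hF_nonneg hF_zero hF_grad hF_lip hA_ker hA_coercive hp hF_small
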